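/- **Theorem 1.10.** Definitions. All graphs are simple and countable. $K_{\mathbb N}$ is the complete graph on $\mathbb N=\{0,1,2,\dots\}$. For a graph $G$ and $S\subseteq V(G)$ let $N(S)=\bigcup_{v\in S}N(v)$ be the set of vertices with a neighbour in $S$. A set $X\subseteq V(G)$ is *dominating* if every vertex of $V(G)\setminus X$ has a neighbour in $X$. A *leaf* is a vertex of degree $1$. - $G$ is *weakly expanding* if for all $k\in\mathbb N$ there is $\ell\in\mathbb N$ such that every independent set $A$ in $G$ with $|A|\ge \ell$ satisfies $|N(A)|>k$. - $G$ is *strongly contracting* if there is $k\in\mathbb N$ such that for every $\ell\in\mathbb N$ there is an independent set $A$ in $G$ with $|A|\ge\ell$ and $|N(A)|\le k$. - $\mathcal T^*$ is the family of forests $T$ with a vertex $t$ of infinite degree such that, for some $d\in\mathbb N$, every vertex other than $t$ has degree at most $d$; $t$ is adjacent to infinitely many leaves and to infinitely many non-leaves; and all but finitely many vertices of $T$ are at distance at most $2$ from $t$ (vertices in different components being at infinite distance). - The *lower density* of $S\subseteq\mathbb N$ is $\liminf_{t\to\infty}|S\cap\{0,1,\dots,t\}|/t$. - A *monochromatic copy*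 of $G$ in a $2$-colouring of the edges of $K_{\mathbb N}$ is the image of $G$ under an injective map $f:V(G)\to\mathbb N$ that sends all edges of $G$ to edges of one colour; its vertex set is $f(V(G))$. - $G$ is *Ramsey-cofinite* if in every $2$-colouring of the edges of $K_{\mathbb N}$ there is a monochromatic copy of $G$ whose vertex set has finite complement in $\mathbb N$; $G$ is *Ramsey-lower-dense* if in every $2$-colouring of the edges of $K_{\mathbb N}$ there is a monochromatic copy of $G$ whose vertex set has positive lower density. Statement. Let $T$ be a countable forest. (i) If $T$ is strongly contracting, has no finite dominating set, and $T\notin\mathcal T^*$, then $T$ is Ramsey-cofinite. (ii) If $T$ is weakly expanding, or has a finite dominating set, or $T\in\mathcal T^*$, then $T$ is not Ramsey-lower-dense (and thus $T$ is not Ramsey-cofinite). -/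

import Mathlib

namespace RamseyForest

open Filter

variable {V : Type*}

/-- `N(S) = ⋃_{v ∈ S} N(v)`, the set of vertices having a neighbour in `S`. -/
def nbhd (G : SimpleGraph V) (S : Set V) : Set V :=
  ⋃ v ∈ S, G.neighborSet v

/-- `G` is weakly expanding: for all `k` there is `ℓ` such that every independent set `A`
with `|A| ≥ ℓ` has `|N(A)| > k`. -/
def WeaklyExpanding (G : SimpleGraph V) : Prop :=
  ∀ k : ℕ, ∃ ℓ : ℕ, ∀ A : Set V, G.IsIndepSet A →
    (ℓ : ℕ∞) ≤ A.encard → (k : ℕ∞) < (nbhd G A).encard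

/-- `G` is strongly contracting: there is `k` such that for all `ℓ` there is an independent
set `A` with `|A| ≥ ℓ` and `|N(A)| ≤ k`. -/
def StronglyContracting (G : SimpleGraph V) : Prop :=
  ∃ k : ℕ, ∀ ℓ : ℕ, ∃ A : Set V, G.IsIndepSet A ∧
    (ℓ : ℕ∞) ≤ A.encard ∧ (nbhd G A).encard ≤ (k : ℕ∞)

/-- `X` is dominating: every vertex outside `X` has a neighbour in `X`. -/
def IsDominating (G : SimpleGraph V) (X : Set V) : Prop :=
  ∀ v, v ∉ X → ∃ u ∈ X, G.Adj v u

/-- `G` has a finite dominating set. -/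
def HasFiniteDominatingSet (G : SimpleGraph V) : Prop :=
  ∃ X : Set V, X.Finite ∧ IsDominating G X

/-- A leaf is a vertex of degree one. -/
def IsLeaf (G : SimpleGraph V) (v : V) : Prop :=
  (G.neighborSet v).encard = 1

/-- Membership in the family `𝒯*`: forests with one vertex `t` of infinite degree, all other
vertices of degree at most `d` for some `d`, such that `t` is adjacent to infinitely many leaves
and infinitely many non-leaves, and all but finitely many vertices are at distance at most `2`
from `t` (the distance between vertices of different components is infinite). -/
def InTStar (T : SimpleGraph V) : Prop :=
  T.IsAcyclic ∧ ∃ (t : V) (d : ℕ),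
    (T.neighborSet t).Infinite ∧
    (∀ v, v ≠ t → (T.neighborSet v).encard ≤ (d : ℕ∞)) ∧
    {v | T.Adj t v ∧ IsLeaf T v}.Infinite ∧
    {v | T.Adj t v ∧ ¬ IsLeaf T v}.Infinite ∧
    {v | ¬ T.edist t v ≤ 2}.Finite

/-- The lower density of `S ⊆ ℕ`: `liminf_{t → ∞} |S ∩ {0, 1, …, t}| / t`. -/
noncomputable def lowerDensity (S : Set ℕ) : ℝ :=
  liminf (fun t : ℕ => ((S ∩ Set.Iic t).ncard : ℝ) / (t : ℝ)) atTop

/-- `G` is Ramsey-cofinite: every 2-colouring of the edges of `K_ℕ` has a monochromatic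
(not necessarily induced) copy of `G` whose vertex set is cofinite in `ℕ`. -/
def RamseyCofinite (G : SimpleGraph V) : Prop :=
  ∀ C : SimpleGraph.TopEdgeLabeling ℕ (Fin 2), ∃ (c : Fin 2)
    (f : SimpleGraph.Copy G (C.labelGraph c)), (Set.range f)ᶜ.Finite

/-- `G` is Ramsey-lower-dense: every 2-colouring of the edges of `K_ℕ` has a monochromatic
(not necessarily induced) copy of `G` whose vertex set has positive lower density. -/
def RamseyLowerDense (G : SimpleGraph V) : Prop :=
  ∀ C : SimpleGraph.TopEdgeLabeling ℕ (Fin 2), ∃ (c : Fin 2)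
    (f : SimpleGraph.Copy G (C.labelGraph c)), 0 < lowerDensity (Set.range f)

end RamseyForest

namespace RamseyForest

open Set Filter

variable {V : Type*}

/-- A forest with a root chosen in every component, given by the parent of each vertex. -/
structure Rooting (T : SimpleGraph V) where
  /-- The parent of a vertex, `none` for a root. -/
  par : V → Option V
  /-- The distance to the root. -/
  dep : V → ℕ
  adj_iff : ∀ u v, T.Adj u v ↔ par u = some v ∨ par v = some u
  dep_par : ∀ u v, par u = some v → dep u = dep v + 1

theorem eq_of_adj_of_dist {T : SimpleGraph V} (hT : T.IsAcyclic) {r v u u' : V}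
    (hr : T.Reachable r v) (hu : T.Adj v u) (hu' : T.Adj v u')
    (hd : T.dist r v = T.dist r u + 1) (hd' : T.dist r v = T.dist r u' + 1) : u = u' := by
  classical
  obtain ⟨q, hq, hql⟩ := hr.exists_path_of_dist
  have key : ∀ w, T.Adj v w → T.dist r v = T.dist r w + 1 → w = q.penultimate := by
    intro w hw hdw
    obtain ⟨p, hp, hpl⟩ := (hr.trans hw.reachable).exists_path_of_dist
    have hv : v ∉ p.support := by
      intro hv
      have h1 := T.dist_le (p.takeUntil v hv)
      have h2 := p.length_takeUntil_le_length hv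
      omega
    have hwq : w ∈ q.support :=
      hT.mem_support_of_ne_mem_support_of_adj_of_isPath hq hp hw hv
    exact hT.eq_penultimate_of_adj_end hq hw hwq
  rw [key u hu hd, key u' hu' hd']

theorem exists_rooting {T : SimpleGraph V} (hT : T.IsAcyclic) (r : V → V)
    (h1 : ∀ v, T.Reachable (r v) v) (h2 : ∀ u v, T.Reachable u v → r u = r v) :
    ∃ ρ : Rooting T, (∀ v, r v = v → ρ.par v = none) ∧ ∀ v, ρ.par v = none → r v = v := by
  classical
  have hpar : ∀ v, r v ≠ v → ∃ u, T.Adj v u ∧ T.dist (r v) v = T.dist (r v) u + 1 := by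
    intro v hv
    obtain ⟨q, hq⟩ := (h1 v).exists_walk_length_eq_dist
    have hnil : ¬ q.Nil := fun h => hv h.eq
    refine ⟨q.penultimate, (q.adj_penultimate hnil).symm, ?_⟩
    have hpos := (h1 v).pos_dist_of_ne hv
    have h3 : T.dist (r v) q.penultimate ≤ q.length - 1 := by
      have := T.dist_le (q.dropLast)
      simpa using this
    have := (q.adj_penultimate hnil).symm.diff_dist_adj (u := r v)
    omega
  refine ⟨⟨fun v => if h : r v ≠ v then some (hpar v h).choose else none,
    fun v => T.dist (r v) v, ?_, ?_⟩, ?_, ?_⟩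
  · intro u v
    constructor
    · intro h
      have hr : r u = r v := h2 _ _ h.reachable
      have key : ∀ u v, T.Adj u v → r u = r v → T.dist (r u) u = T.dist (r u) v + 1 →
          (if h : r u ≠ u then some (hpar u h).choose else none) = some v := by
        intro u v h hr hd
        have hne : r u ≠ u := by
          intro h'
          rw [h'] at hd
          simp at hd
        rw [dif_pos hne]
        have hc := (hpar u hne).choose_spec
        rw [eq_of_adj_of_dist hT (h1 u) hc.1 h hc.2 hd]
      rcases hT.dist_eq_dist_add_one_of_adj_of_reachable (r u) h (h1 u) with hd | hd
      · exact Or.inl (key u v h hr hd)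
      · exact Or.inr (key v u h.symm hr.symm (by rwa [← hr]))
    · have key : ∀ u v, (if h : r u ≠ u then some (hpar u h).choose else none) = some v →
          T.Adj u v := by
        intro u v h
        split_ifs at h with hne
        simp only [Option.some.injEq] at h
        exact h ▸ (hpar u hne).choose_spec.1
      rintro (h | h)
      · exact key u v h
      · exact (key v u h).symm
  · intro u v h
    split_ifs at h with hne
    simp only [Option.some.injEq] at h
    have hc := (hpar u hne).choose_spec
    rw [h] at hc
    rw [hc.2, h2 u v hc.1.reachable]
  · intro v hv
    simp [hv]
  · intro v hv
    by_contra hne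
    simp [hne] at hv

/-- A rooting in which `t` is a root, and so is `x` unless it lies in the component of `t`. -/
theorem exists_rooting_pair {T : SimpleGraph V} (hT : T.IsAcyclic) (t x : V) :
    ∃ ρ : Rooting T, ρ.par t = none ∧ (¬ T.Reachable t x → ρ.par x = none) ∧
      (∀ v, T.Reachable t v → ρ.par v = none → v = t) := by
  classical
  let r : V → V := fun v => if T.Reachable t v then t else if T.Reachable x v then x else
    (T.connectedComponentMk v).nonempty_supp.some
  have hr : ∀ v, T.Reachable (r v) v := by
    intro v
    simp only [r]
    split_ifs with h h'
    · exact h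
    · exact h'
    · exact SimpleGraph.ConnectedComponent.exact
        (T.connectedComponentMk v).nonempty_supp.some_mem
  obtain ⟨ρ, h1, h2⟩ := exists_rooting hT r hr (by
    intro u v h
    have e1 : T.Reachable t u ↔ T.Reachable t v := ⟨fun k => k.trans h, fun k => k.trans h.symm⟩
    have e2 : T.Reachable x u ↔ T.Reachable x v := ⟨fun k => k.trans h, fun k => k.trans h.symm⟩
    have e3 := SimpleGraph.ConnectedComponent.sound h
    simp only [r, e1, e2, e3])
  refine ⟨ρ, h1 t (by simp [r]), fun h => h1 x (by simp [r, h]), fun v hv hn => ?_⟩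
  have := h2 v hn
  simpa [r, hv] using this.symm

theorem exists_rooting_at {T : SimpleGraph V} (hT : T.IsAcyclic) (t : V) :
    ∃ ρ : Rooting T, ρ.par t = none := by
  obtain ⟨ρ, h, -⟩ := exists_rooting_pair hT t t
  exact ⟨ρ, h⟩

theorem nonempty_rooting {T : SimpleGraph V} (hT : T.IsAcyclic) : Nonempty (Rooting T) := by
  rcases isEmpty_or_nonempty V with h | ⟨⟨t⟩⟩
  · exact ⟨⟨fun _ => none, fun _ => 0, fun u => (h.false u).elim, fun u => (h.false u).elim⟩⟩
  · obtain ⟨ρ, -⟩ := exists_rooting_at hT t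
    exact ⟨ρ⟩

/-- The finite partial map `(S', f')` extends `(S, f)`. -/
def Extends (S : Set V) (f : V → ℕ) (S' : Set V) (f' : V → ℕ) : Prop :=
  S ⊆ S' ∧ ∀ v ∈ S, f' v = f v

theorem Extends.refl (S : Set V) (f : V → ℕ) : Extends S f S f :=
  ⟨Subset.rfl, fun _ _ => rfl⟩

theorem Extends.trans {S S' S'' : Set V} {f f' f'' : V → ℕ} (h : Extends S f S' f')
    (h' : Extends S' f' S'' f'') : Extends S f S'' f'' :=
  ⟨h.1.trans h'.1, fun v hv => (h'.2 v (h.1 hv)).trans (h.2 v hv)⟩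

theorem image_insert_of_eq {S : Set V} {f f' : V → ℕ} {v : V} (h : ∀ u ∈ S, f' u = f u) :
    f' '' insert v S = insert (f' v) (f '' S) := by
  rw [image_insert_eq, image_congr h]

/-- Countably many dense requirements on partial embeddings are met by one copy. -/
theorem exists_copy [Countable V] {T : SimpleGraph V} {H : SimpleGraph ℕ} {A : Set ℕ}
    (P : Set V → (V → ℕ) → Prop) (h0 : ∃ S f, P S f)
    (hinj : ∀ S f, P S f → InjOn f S)
    (hadj : ∀ S f, P S f → ∀ u ∈ S, ∀ v ∈ S, T.Adj u v → H.Adj (f u) (f v))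
    (ext : ∀ S f, P S f → ∀ v, v ∉ S → ∃ S' f', P S' f' ∧ Extends S f S' f' ∧ v ∈ S')
    (cov : ∀ S f, P S f → ∀ n ∈ A, n ∉ f '' S →
      ∃ S' f', P S' f' ∧ Extends S f S' f' ∧ n ∈ f' '' S') :
    ∃ φ : SimpleGraph.Copy T H, A ⊆ range φ := by
  classical
  obtain ⟨e, he⟩ := exists_surjective_nat (Option V)
  have step : ∀ (k : ℕ) (p : {p : Set V × (V → ℕ) // P p.1 p.2}),
      ∃ q : {p : Set V × (V → ℕ) // P p.1 p.2}, Extends p.1.1 p.1.2 q.1.1 q.1.2 ∧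
        (∀ v, e k = some v → v ∈ q.1.1) ∧ (k ∈ A → k ∈ q.1.2 '' q.1.1) := by
    rintro k ⟨⟨S, f⟩, hp⟩
    obtain ⟨S1, f1, hp1, hE1, hv1⟩ : ∃ S' f', P S' f' ∧ Extends S f S' f' ∧
        (∀ v, e k = some v → v ∈ S') := by
      by_cases h : ∃ v, e k = some v ∧ v ∉ S
      · obtain ⟨v, hv, hvS⟩ := h
        obtain ⟨S', f', h1, h2, h3⟩ := ext S f hp v hvS
        refine ⟨S', f', h1, h2, fun w hw => ?_⟩
        rw [hv, Option.some.injEq] at hw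
        exact hw ▸ h3
      · push Not at h
        exact ⟨S, f, hp, Extends.refl _ _, h⟩
    by_cases h : k ∈ A ∧ k ∉ f1 '' S1
    · obtain ⟨S', f', h1, h2, h3⟩ := cov S1 f1 hp1 k h.1 h.2
      exact ⟨⟨(S', f'), h1⟩, hE1.trans h2, fun v hv => h2.1 (hv1 v hv), fun _ => h3⟩
    · push Not at h
      exact ⟨⟨(S1, f1), hp1⟩, hE1, hv1, h⟩
  choose g hg1 hg2 hg3 using step
  obtain ⟨S0, f0, hp0⟩ := h0
  let s : ℕ → {p : Set V × (V → ℕ) // P p.1 p.2} := fun n => Nat.rec ⟨(S0, f0), hp0⟩ g n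
  have hs : ∀ n, s (n + 1) = g n (s n) := fun n => rfl
  have hmono : ∀ m n, m ≤ n → Extends (s m).1.1 (s m).1.2 (s n).1.1 (s n).1.2 := by
    intro m n h
    induction n, h using Nat.le_induction with
    | base => exact Extends.refl _ _
    | succ n _ ih => exact ih.trans (by rw [hs]; exact hg1 n _)
  have hidx : ∀ v, ∃ n, v ∈ (s n).1.1 := by
    intro v
    obtain ⟨k, hk⟩ := he (some v)
    exact ⟨k + 1, by rw [hs]; exact hg2 k _ v hk⟩
  choose i hi using hidx
  let F : V → ℕ := fun v => (s (i v)).1.2 v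
  have hF : ∀ n v, v ∈ (s n).1.1 → F v = (s n).1.2 v := by
    intro n v hv
    rcases le_total n (i v) with h | h
    · exact (hmono _ _ h).2 v hv
    · exact ((hmono _ _ h).2 v (hi v)).symm
  have hpair : ∀ u v, ∃ n, u ∈ (s n).1.1 ∧ v ∈ (s n).1.1 := fun u v =>
    ⟨max (i u) (i v), (hmono _ _ (le_max_left _ _)).1 (hi u),
      (hmono _ _ (le_max_right _ _)).1 (hi v)⟩
  refine ⟨⟨⟨F, ?_⟩, ?_⟩, ?_⟩
  · intro u v huv
    obtain ⟨n, hu, hv⟩ := hpair u v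
    rw [hF n u hu, hF n v hv]
    exact hadj _ _ (s n).2 u hu v hv huv
  · intro u v huv
    obtain ⟨n, hu, hv⟩ := hpair u v
    change F u = F v at huv
    rw [hF n u hu, hF n v hv] at huv
    exact hinj _ _ (s n).2 hu hv huv
  · intro n hn
    have : n ∈ (s (n + 1)).1.2 '' (s (n + 1)).1.1 := by rw [hs]; exact hg3 n _ hn
    obtain ⟨v, hv, hvn⟩ := this
    exact ⟨v, (hF (n + 1) v hv).trans hvn⟩

/-- A finite partial embedding of a rooted forest whose domain is closed under parents, and which
sends every vertex having a child into `W`. -/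
structure RState {T : SimpleGraph V} (ρ : Rooting T) (H : SimpleGraph ℕ) (W : Set ℕ)
    (S : Set V) (f : V → ℕ) : Prop where
  fin : S.Finite
  down : ∀ u v, u ∈ S → ρ.par u = some v → v ∈ S
  inj : InjOn f S
  adj : ∀ u v, u ∈ S → ρ.par u = some v → H.Adj (f u) (f v)
  inW : ∀ u v, v ∈ S → ρ.par u = some v → f v ∈ W

section RState

variable {T : SimpleGraph V} {ρ : Rooting T} {H : SimpleGraph ℕ} {W : Set ℕ} {S : Set V}
  {f : V → ℕ}

theorem RState.empty (f : V → ℕ) : RState ρ H W ∅ f :=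
  ⟨finite_empty, by simp, by simp, by simp, by simp⟩

theorem RState.add (h : RState ρ H W S f) {v : V} (hv : v ∉ S) {n : ℕ} (hn : n ∉ f '' S)
    (hpar : ∀ u, ρ.par v = some u → u ∈ S ∧ H.Adj n (f u))
    (hW : ∀ u, ρ.par u = some v → n ∈ W) :
    ∃ f', RState ρ H W (insert v S) f' ∧ (∀ u ∈ S, f' u = f u) ∧ f' v = n := by
  classical
  have hS : ∀ u ∈ S, Function.update f v n u = f u := fun u hu =>
    Function.update_of_ne (ne_of_mem_of_not_mem hu hv) _ _
  have hvn : Function.update f v n v = n := Function.update_self ..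
  refine ⟨Function.update f v n, ⟨h.fin.insert v, ?_, ?_, ?_, ?_⟩, hS, hvn⟩
  · rintro u w (rfl | hu) hw
    · exact mem_insert_of_mem _ (hpar w hw).1
    · exact mem_insert_of_mem _ (h.down u w hu hw)
  · rw [injOn_insert hv, image_congr hS, hvn]
    exact ⟨h.inj.congr fun u hu => (hS u hu).symm, hn⟩
  · rintro u w (rfl | hu) hw
    · rw [hvn, hS _ (hpar w hw).1]
      exact (hpar w hw).2
    · rw [hS u hu, hS w (h.down u w hu hw)]
      exact h.adj u w hu hw
  · rintro u w (rfl | hu) hw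
    · rw [hvn]
      exact hW u hw
    · rw [hS w hu]
      exact h.inW u w hu hw

theorem RState.adj_of_adj (h : RState ρ H W S f) {u v : V} (hu : u ∈ S) (hv : v ∈ S)
    (huv : T.Adj u v) : H.Adj (f u) (f v) := by
  rcases (ρ.adj_iff u v).1 huv with h' | h'
  · exact h.adj u v hu h'
  · exact (h.adj v u hv h').symm

/-- The image of a partial embedding contains the fibre over each of its points. -/
def FibClosed (Fib : ℕ → Set ℕ) (A : Set ℕ) : Prop :=
  ∀ y ∈ A, Fib y ⊆ A

theorem FibClosed.insert {Fib : ℕ → Set ℕ} {A : Set ℕ} (h : FibClosed Fib A) {n : ℕ}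
    (hn : Fib n = ∅) : FibClosed Fib (insert n A) := by
  rintro y (rfl | hy)
  · simp [hn]
  · exact (h y hy).trans (subset_insert _ _)

theorem RState.ext {Gn : Set ℕ} {Fib : ℕ → Set ℕ} (hGW : Gn ⊆ W) (hGinf : Gn.Infinite)
    (hG : ∀ w ∈ W, (H.neighborSet w ∩ Gn).Infinite) (hFib : ∀ g ∈ Gn, Fib g = ∅) (v : V) :
    ∀ (S : Set V) (f : V → ℕ), RState ρ H W S f → FibClosed Fib (f '' S) →
    ∃ S' f', RState ρ H W S' f' ∧ FibClosed Fib (f' '' S') ∧ Extends S f S' f' ∧ v ∈ S' := by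
  obtain ⟨k, hk⟩ : ∃ k, ρ.dep v = k := ⟨_, rfl⟩
  induction k using Nat.strong_induction_on generalizing v with
  | _ k ih =>
  intro S f h hF
  by_cases hv : v ∈ S
  · exact ⟨S, f, h, hF, Extends.refl _ _, hv⟩
  cases hp : ρ.par v with
  | none =>
    obtain ⟨n, hn, hnS⟩ := Set.Infinite.exists_notMem_finite hGinf (h.fin.image f)
    obtain ⟨f', h1, h2, h3⟩ := h.add hv hnS (by simp [hp]) (fun _ _ => hGW hn)
    refine ⟨_, f', h1, ?_, ⟨subset_insert _ _, h2⟩, mem_insert _ _⟩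
    rw [image_insert_of_eq h2, h3]
    exact hF.insert (hFib n hn)
  | some u =>
    obtain ⟨S1, f1, k1, k2, k3, k4⟩ := ih (ρ.dep u) (by have := ρ.dep_par v u hp; omega) u rfl S f
      h hF
    by_cases hv1 : v ∈ S1
    · exact ⟨S1, f1, k1, k2, k3, hv1⟩
    obtain ⟨n, hn, hnS⟩ := Set.Infinite.exists_notMem_finite (hG _ (k1.inW v u k4 hp))
      (k1.fin.image f1)
    obtain ⟨f', h1, h2, h3⟩ := k1.add hv1 hnS (by
      intro w hw
      rw [hp, Option.some.injEq] at hw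
      subst hw
      exact ⟨k4, hn.1.symm⟩) (fun _ _ => hGW hn.2)
    refine ⟨_, f', h1, ?_, k3.trans ⟨subset_insert _ _, h2⟩, mem_insert _ _⟩
    rw [image_insert_of_eq h2, h3]
    exact k2.insert (hFib n hn.2)

theorem rooted_copy_fib [Countable V] (ρ : Rooting T) {Gn A : Set ℕ} {Fib : ℕ → Set ℕ}
    (hGW : Gn ⊆ W) (hGinf : Gn.Infinite) (hG : ∀ w ∈ W, (H.neighborSet w ∩ Gn).Infinite)
    (hFib : ∀ g ∈ Gn, Fib g = ∅)
    {S₀ : Set V} {f₀ : V → ℕ} (h₀ : RState ρ H W S₀ f₀) (hF₀ : FibClosed Fib (f₀ '' S₀))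
    (cov : ∀ S f, RState ρ H W S f → FibClosed Fib (f '' S) → Extends S₀ f₀ S f →
      ∀ n ∈ A, n ∉ f '' S → ∃ S' f', RState ρ H W S' f' ∧ FibClosed Fib (f' '' S') ∧
        Extends S f S' f' ∧ n ∈ f' '' S') :
    ∃ φ : SimpleGraph.Copy T H, A ⊆ range φ := by
  refine exists_copy (fun S f => RState ρ H W S f ∧ FibClosed Fib (f '' S) ∧ Extends S₀ f₀ S f)
    ⟨S₀, f₀, h₀, hF₀, Extends.refl _ _⟩ (fun S f h => h.1.inj)
    (fun S f h u hu v hv huv => h.1.adj_of_adj hu hv huv) ?_ ?_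
  · rintro S f ⟨h1, h2, h3⟩ v -
    obtain ⟨S', f', k1, k2, k3, k4⟩ := RState.ext hGW hGinf hG hFib v S f h1 h2
    exact ⟨S', f', ⟨k1, k2, h3.trans k3⟩, k3, k4⟩
  · rintro S f ⟨h1, h2, h3⟩ n hn hnS
    obtain ⟨S', f', k1, k2, k3, k4⟩ := cov S f h1 h2 h3 n hn hnS
    exact ⟨S', f', ⟨k1, k2, h3.trans k3⟩, k3, k4⟩

theorem rooted_copy [Countable V] (ρ : Rooting T) {A : Set ℕ} (hWinf : W.Infinite)
    (hW : ∀ w ∈ W, (H.neighborSet w ∩ W).Infinite)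
    {S₀ : Set V} {f₀ : V → ℕ} (h₀ : RState ρ H W S₀ f₀)
    (cov : ∀ S f, RState ρ H W S f → Extends S₀ f₀ S f →
      ∀ n ∈ A, n ∉ f '' S → ∃ S' f', RState ρ H W S' f' ∧ Extends S f S' f' ∧ n ∈ f' '' S') :
    ∃ φ : SimpleGraph.Copy T H, A ⊆ range φ := by
  refine rooted_copy_fib ρ (Fib := fun _ => ∅) Subset.rfl hWinf hW (by simp) h₀
    (by simp [FibClosed]) ?_
  intro S f h1 _ h3 n hn hnS
  obtain ⟨S', f', k1, k3, k4⟩ := cov S f h1 h3 n hn hnS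
  exact ⟨S', f', k1, by simp [FibClosed], k3, k4⟩

end RState

theorem lowerDensity_nonpos {S : Set ℕ}
    (h : ∀ ε : ℝ, 0 < ε → ∃ᶠ t : ℕ in atTop, ((S ∩ Iic t).ncard : ℝ) / (t : ℝ) ≤ ε) :
    lowerDensity S ≤ 0 := by
  refine le_of_forall_pos_le_add fun ε hε => ?_
  rw [zero_add]
  refine liminf_le_of_frequently_le (h ε hε) ⟨0, ?_⟩
  refine eventually_map.2 (Eventually.of_forall fun t => ?_)
  exact div_nonneg (Nat.cast_nonneg _) (Nat.cast_nonneg _)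

theorem lowerDensity_pos_of_cofinite {S : Set ℕ} (h : Sᶜ.Finite) : 0 < lowerDensity S := by
  refine lt_of_lt_of_le (by norm_num : (0 : ℝ) < 1 / 2) ?_
  have hle : ∀ t : ℕ, t + 1 ≤ (S ∩ Iic t).ncard + Sᶜ.ncard := by
    intro t
    have h1 : (Iic t).ncard = t + 1 := by
      rw [← Finset.coe_Iic, ncard_coe_finset, Nat.card_Iic]
    rw [← h1]
    refine (ncard_le_ncard (t := (S ∩ Iic t) ∪ Sᶜ) ?_
      (((finite_Iic t).inter_of_right _).union h)).trans (ncard_union_le _ _)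
    intro x hx
    by_cases hxS : x ∈ S
    · exact Or.inl ⟨hxS, hx⟩
    · exact Or.inr hxS
  refine le_liminf_of_le ⟨2, ?_⟩ ?_
  · intro a ha
    obtain ⟨t, ht, ht1⟩ := (((eventually_map.1 ha)).and (eventually_ge_atTop 1)).exists
    refine ht.trans ?_
    have h1 : (S ∩ Iic t).ncard ≤ t + 1 := by
      refine (ncard_le_ncard inter_subset_right (finite_Iic t)).trans ?_
      rw [← Finset.coe_Iic, ncard_coe_finset, Nat.card_Iic]
    have h2 : (0 : ℝ) < t := by exact_mod_cast ht1
    rw [div_le_iff₀ h2]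
    have : ((S ∩ Iic t).ncard : ℝ) ≤ t + 1 := by exact_mod_cast h1
    have : (1 : ℝ) ≤ t := by exact_mod_cast ht1
    linarith
  · filter_upwards [eventually_ge_atTop (2 * Sᶜ.ncard + 1)] with t ht
    have h2 : (0 : ℝ) < t := by
      have : 0 < t := by omega
      exact_mod_cast this
    rw [div_le_div_iff₀ (by norm_num) h2]
    have := hle t
    have h3 : t ≤ (S ∩ Iic t).ncard * 2 := by omega
    rw [one_mul]
    exact_mod_cast h3

/-- Rapidly growing consecutive intervals `[a k, a (k + 1))`; `b j` is the index of the interval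
containing `j`. -/
theorem exists_blocks (h : ℕ → ℕ) : ∃ a b : ℕ → ℕ, StrictMono a ∧
    (∀ j, a (b j) ≤ j ∧ j < a (b j + 1)) ∧
    ∀ S : Set ℕ, (∃ᶠ k in atTop, (S ∩ Iio (a (k + 1))).ncard ≤ h (a k)) →
      lowerDensity S ≤ 0 := by
  let a : ℕ → ℕ := fun k => Nat.rec 0 (fun _ n => (n + 1) * (h n + 1) + 1) k
  have ha : ∀ k, a (k + 1) = (a k + 1) * (h (a k) + 1) + 1 := fun k => rfl
  have hmono : StrictMono a := strictMono_nat_of_lt_succ fun k => by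
    rw [ha]
    nlinarith [Nat.zero_le (h (a k)), Nat.zero_le (a k)]
  have hb : ∀ j, ∃ k, a k ≤ j ∧ j < a (k + 1) := by
    intro j
    induction j with
    | zero => exact ⟨0, le_rfl, by rw [ha]; positivity⟩
    | succ j ih =>
      obtain ⟨k, h1, h2⟩ := ih
      rcases lt_or_ge (j + 1) (a (k + 1)) with h3 | h3
      · exact ⟨k, by omega, h3⟩
      · exact ⟨k + 1, h3, lt_of_le_of_lt (by omega) (hmono (Nat.lt_succ_self (k + 1)))⟩
  choose b hb using hb
  refine ⟨a, b, hmono, hb, fun S hS => lowerDensity_nonpos fun ε hε => ?_⟩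
  obtain ⟨N, hN⟩ := exists_nat_one_div_lt hε
  rw [frequently_atTop] at hS ⊢
  intro m
  obtain ⟨k, hk, hk2⟩ := hS (max m N)
  have hka : k ≤ a k := hmono.le_apply
  refine ⟨(a k + 1) * (h (a k) + 1), ?_, ?_⟩
  · have : m ≤ k := (le_max_left _ _).trans hk
    nlinarith [Nat.zero_le (h (a k)), Nat.zero_le (a k)]
  · have e : Iic ((a k + 1) * (h (a k) + 1)) = Iio (a (k + 1)) := by
      ext x
      rw [mem_Iic, mem_Iio, ha, Nat.lt_succ_iff]
    rw [e]
    refine le_trans ?_ hN.le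
    rw [div_le_div_iff₀ (by positivity) (by positivity), one_mul]
    have h1 : N + 1 ≤ a k + 1 := by have := (le_max_right m N).trans hk; omega
    have : (S ∩ Iio (a (k + 1))).ncard * (N + 1) ≤ (a k + 1) * (h (a k) + 1) := by
      calc _ ≤ h (a k) * (a k + 1) := Nat.mul_le_mul hk2 h1
        _ ≤ _ := by nlinarith
    exact_mod_cast this

theorem block_mono {a b : ℕ → ℕ} (ha : StrictMono a) (hb : ∀ j, a (b j) ≤ j ∧ j < a (b j + 1))
    {i j : ℕ} (h : i ≤ j) : b i ≤ b j := by
  by_contra hlt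
  push Not at hlt
  have := ha.monotone (show b j + 1 ≤ b i by omega)
  have h1 := (hb i).1
  have h2 := (hb j).2
  omega

theorem block_eq {a b : ℕ → ℕ} (ha : StrictMono a) (hb : ∀ j, a (b j) ≤ j ∧ j < a (b j + 1))
    {k j : ℕ} (h1 : a k ≤ j) (h2 : j < a (k + 1)) : b j = k := by
  have h3 : k < b j + 1 := ha.lt_iff_lt.1 (h1.trans_lt (hb j).2)
  have h4 : b j < k + 1 := ha.lt_iff_lt.1 ((hb j).1.trans_lt h2)
  omega

/-- A two-colouring prescribed on the pairs `i < j`. -/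
theorem exists_labeling (col : ℕ → ℕ → Fin 2) : ∃ C : SimpleGraph.TopEdgeLabeling ℕ (Fin 2),
    ∀ c i j, i < j → (C.labelGraph c).Adj i j → col i j = c := by
  refine ⟨SimpleGraph.EdgeLabeling.mk (fun x y _ => col (min x y) (max x y)) ?_, ?_⟩
  · intro x y _
    simp only [min_comm, max_comm]
  · intro c i j hij h
    rw [SimpleGraph.TopEdgeLabeling.labelGraph_adj] at h
    obtain ⟨_, h⟩ := h
    rwa [SimpleGraph.EdgeLabeling.get_mk, min_eq_left hij.le, max_eq_right hij.le] at h

theorem not_ramseyLowerDense_of_weaklyExpanding {T : SimpleGraph V} (hT : WeaklyExpanding T) :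
    ¬ RamseyLowerDense T := by
  choose l hl using hT
  obtain ⟨a, b, ha, hb, hS⟩ := exists_blocks (fun n => n + l n)
  obtain ⟨C, hC⟩ := exists_labeling (fun i _ => Fin.ofNat 2 (b i))
  intro hR
  obtain ⟨c, f, hf⟩ := hR C
  refine absurd hf (not_lt.2 (hS _ ?_))
  rw [frequently_atTop]
  intro m
  refine ⟨2 * m + (c + 1), by omega, ?_⟩
  set k := 2 * m + ((c : ℕ) + 1) with hk
  have hkc : Fin.ofNat 2 k ≠ c := by
    intro h
    have := congrArg Fin.val h
    simp only [Fin.val_ofNat] at this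
    omega
  set A : Set V := {v | a k ≤ f v ∧ f v < a (k + 1)} with hA
  have hnb : ∀ u ∈ A, ∀ v, T.Adj u v → f v < a k := by
    intro u hu v huv
    by_contra hlt
    push Not at hlt
    have hadj := f.toHom.map_adj huv
    have hbu : b (f u) = k := block_eq ha hb hu.1 hu.2
    rcases lt_trichotomy (f u) (f v) with h | h | h
    · have := hC c _ _ h hadj
      rw [hbu] at this
      exact hkc this
    · exact huv.ne (f.injective h)
    · have := hC c _ _ h hadj.symm
      rw [block_eq ha hb hlt (h.trans hu.2)] at this
      exact hkc this
  have hind : T.IsIndepSet A := by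
    intro u hu v hv _ huv
    exact absurd (hnb u hu v huv) (not_lt.2 hv.1)
  have hN : (nbhd T A).encard ≤ (a k : ℕ∞) := by
    have h1 : f '' nbhd T A ⊆ Iio (a k) := by
      rintro _ ⟨v, hv, rfl⟩
      simp only [nbhd, mem_iUnion, SimpleGraph.mem_neighborSet] at hv
      obtain ⟨u, hu, huv⟩ := hv
      exact hnb u hu v huv
    rw [← f.injective.encard_image]
    refine (encard_le_encard h1).trans ?_
    rw [← Finset.coe_Iio, encard_coe_eq_coe_finsetCard, Nat.card_Iio]
  have hAl : A.encard < l (a k) := by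
    by_contra hlt
    push Not at hlt
    exact absurd (hl (a k) A hind hlt) (not_lt.2 hN)
  have hAfin : A.Finite := finite_of_encard_le_coe hAl.le
  have hAn : A.ncard ≤ l (a k) := by
    rw [← hAfin.cast_ncard_eq] at hAl
    exact_mod_cast hAl.le
  have hsub : range f ∩ Iio (a (k + 1)) ⊆ Iio (a k) ∪ f '' A := by
    rintro _ ⟨⟨v, rfl⟩, hv⟩
    rcases lt_or_ge (f v) (a k) with h | h
    · exact Or.inl h
    · exact Or.inr ⟨v, ⟨h, hv⟩, rfl⟩
  calc _ ≤ (Iio (a k) ∪ f '' A).ncard :=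
        ncard_le_ncard hsub ((finite_Iio _).union (hAfin.image _))
    _ ≤ (Iio (a k)).ncard + (f '' A).ncard := ncard_union_le _ _
    _ ≤ a k + l (a k) := by
        refine add_le_add ?_ ((ncard_image_le hAfin).trans hAn)
        rw [← Finset.coe_Iio, ncard_coe_finset, Nat.card_Iio]

theorem not_ramseyLowerDense_of_hasFiniteDominatingSet {T : SimpleGraph V}
    (hT : HasFiniteDominatingSet T) : ¬ RamseyLowerDense T := by
  obtain ⟨X, hX, hdom⟩ := hT
  obtain ⟨a, b, ha, hb, hS⟩ := exists_blocks (fun n => n)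
  obtain ⟨C, hC⟩ := exists_labeling (fun _ j => Fin.ofNat 2 (b j))
  intro hR
  obtain ⟨c, f, hf⟩ := hR C
  refine absurd hf (not_lt.2 (hS _ ?_))
  obtain ⟨M, hM⟩ := (hX.image f).bddAbove
  rw [frequently_atTop]
  intro m
  refine ⟨2 * (m + M) + (c + 1), by omega, ?_⟩
  set k := 2 * (m + M) + ((c : ℕ) + 1) with hk
  have hkc : Fin.ofNat 2 k ≠ c := by
    intro h
    have := congrArg Fin.val h
    simp only [Fin.val_ofNat] at this
    omega
  have hMk : M < a k := lt_of_lt_of_le (by omega) ha.le_apply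
  have hsub : range f ∩ Iio (a (k + 1)) ⊆ Iio (a k) := by
    rintro _ ⟨⟨v, rfl⟩, hv⟩
    by_contra hlt
    simp only [mem_Iio, not_lt] at hlt
    have hvX : v ∉ X := fun h => absurd (hM (mem_image_of_mem f h)) (by omega)
    obtain ⟨u, hu, hvu⟩ := hdom v hvX
    have hle : f u ≤ M := hM (mem_image_of_mem f hu)
    have := hC c (f u) (f v) (by omega) (f.toHom.map_adj hvu.symm)
    rw [block_eq ha hb hlt hv] at this
    exact hkc this
  refine (ncard_le_ncard hsub (finite_Iio _)).trans ?_
  rw [← Finset.coe_Iio, ncard_coe_finset, Nat.card_Iio]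

theorem not_ramseyLowerDense_of_inTStar {T : SimpleGraph V} (hT : InTStar T) :
    ¬ RamseyLowerDense T := by
  classical
  obtain ⟨-, t, d, -, hd, -, -, hE⟩ := hT
  obtain ⟨a, b, ha, hb, hS⟩ := exists_blocks (fun n => (n + 1) * (n + 1))
  obtain ⟨C, hC⟩ := exists_labeling (fun i j => if b i = b j then
    Fin.ofNat 2 (b i + b i / 2 + 1) else Fin.ofNat 2 (b i + b j / 2))
  intro hR
  obtain ⟨c, f, hf⟩ := hR C
  refine absurd hf (not_lt.2 (hS _ ?_))
  set E : Set V := {v | ¬ T.edist t v ≤ 2} with hEdef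
  rw [frequently_atTop]
  intro m
  obtain ⟨k, hkm, hk1, hk2⟩ : ∃ k, m + b (f t) + d + E.ncard + 1 ≤ k ∧
      k % 2 = (b (f t) + 1) % 2 ∧ (k / 2) % 2 = (c + k) % 2 := by
    have hc : (c : ℕ) < 2 := c.2
    obtain ⟨x, hx⟩ : ∃ x, x = ((c : ℕ) + b (f t) + 1) % 2 := ⟨_, rfl⟩
    obtain ⟨y, hy⟩ : ∃ y, y = (b (f t) + 1) % 2 := ⟨_, rfl⟩
    obtain ⟨N, hN⟩ : ∃ N, N = m + b (f t) + d + E.ncard + 1 := ⟨_, rfl⟩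
    have hdiv : (4 * N + (2 * x + y)) / 2 = 2 * N + x := by omega
    refine ⟨4 * N + (2 * x + y), by omega, by omega, ?_⟩
    rw [hdiv]
    omega
  refine ⟨k, by omega, ?_⟩
  have hval : ∀ n : ℕ, Fin.ofNat 2 n = c → n % 2 = c := by
    intro n h
    simpa using congrArg Fin.val h
  have hc2 : (c : ℕ) < 2 := c.2
  have hfi : Function.Injective f := f.injective
  set B : Set V := {w | w ≠ t ∧ f w < a k} with hB
  have hBfin : B.Finite := by
    refine Finite.of_finite_image ((finite_Iio (a k)).subset ?_) f.injective.injOn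
    rintro _ ⟨w, hw, rfl⟩
    exact hw.2
  have hBcard : hBfin.toFinset.card ≤ a k := by
    have : (f '' B).ncard ≤ (Iio (a k)).ncard := ncard_le_ncard (by
      rintro _ ⟨w, hw, rfl⟩
      exact hw.2) (finite_Iio _)
    rw [ncard_image_of_injective _ hfi, ← Finset.coe_Iio, ncard_coe_finset,
      Nat.card_Iio] at this
    rwa [← ncard_eq_toFinset_card B hBfin]
  have hsub : range f ∩ Iio (a (k + 1)) ⊆
      (Iio (a k) ∪ f '' E) ∪ ⋃ w ∈ hBfin.toFinset, f '' T.neighborSet w := by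
    rintro _ ⟨⟨u, rfl⟩, hu⟩
    rcases lt_or_ge (f u) (a k) with h | h
    · exact Or.inl (Or.inl h)
    by_cases huE : u ∈ E
    · exact Or.inl (Or.inr ⟨u, huE, rfl⟩)
    right
    have hbu : b (f u) = k := block_eq ha hb h hu
    have htu : f t < f u := by
      by_contra hlt
      have := block_mono ha hb (not_lt.1 hlt)
      omega
    have hnadj : ¬ T.Adj t u := by
      intro hadj
      have := hC c _ _ htu (f.toHom.map_adj hadj)
      rw [if_neg (by omega), hbu] at this
      have := hval _ this
      omega
    simp only [hEdef, mem_ofPred_eq, not_not] at huE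
    obtain ⟨w, hw1, hw2⟩ : ∃ w, T.Adj t w ∧ T.Adj w u := by
      by_contra hno
      push Not at hno
      refine absurd huE (not_le.2 (SimpleGraph.two_lt_edist_iff.2 ?_))
      refine ⟨fun h => by simp [h] at htu, hnadj, ?_⟩
      ext w
      simp only [SimpleGraph.mem_commonNeighbors, mem_empty_iff_false, iff_false]
      exact fun h => hno w h.1 h.2.symm
    have hwt : w ≠ t := hw1.ne'
    simp only [mem_iUnion, Finite.mem_toFinset]
    refine ⟨w, ⟨hwt, ?_⟩, u, hw2, rfl⟩
    by_contra hlt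
    have hwk : k ≤ b (f w) := hbu ▸ (by
      rw [hbu, ← block_eq ha hb le_rfl (ha (Nat.lt_succ_self k))]
      exact block_mono ha hb (not_lt.1 hlt))
    have hadj := f.toHom.map_adj hw2
    rcases hwk.eq_or_lt with hwk | hwk
    · rcases lt_trichotomy (f u) (f w) with h' | h' | h'
      · have := hC c _ _ h' hadj.symm
        rw [if_pos (by omega), hbu] at this
        have := hval _ this
        omega
      · exact hw2.ne (f.injective h').symm
      · have := hC c _ _ h' hadj
        rw [if_pos (by omega), ← hwk] at this
        have := hval _ this
        omega
    · have h' : f u < f w := by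
        by_contra hge
        have := block_mono ha hb (not_lt.1 hge)
        omega
      have e1 := hC c _ _ h' hadj.symm
      rw [if_neg (by omega), hbu] at e1
      have e1 := hval _ e1
      have e2 := hC c _ _ (htu.trans h') (f.toHom.map_adj hw1)
      rw [if_neg (by omega)] at e2
      have e2 := hval _ e2
      omega
  have hNfin : ∀ w ∈ hBfin.toFinset, (T.neighborSet w).Finite ∧ (T.neighborSet w).ncard ≤ d := by
    intro w hw
    have h1 := hd w ((hBfin.mem_toFinset.1 hw).1)
    have h2 := finite_of_encard_le_coe h1
    refine ⟨h2, ?_⟩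
    rw [← h2.cast_ncard_eq] at h1
    exact_mod_cast h1
  have hUfin : (⋃ w ∈ hBfin.toFinset, f '' T.neighborSet w).Finite :=
    hBfin.toFinset.finite_toSet.biUnion fun w hw => (hNfin w hw).1.image f
  have hUcard : (⋃ w ∈ hBfin.toFinset, f '' T.neighborSet w).ncard ≤ a k * d := by
    refine (Finset.set_ncard_biUnion_le _ _).trans ?_
    refine (Finset.sum_le_card_nsmul _ _ d fun w hw => ?_).trans ?_
    · rw [ncard_image_of_injective _ hfi]
      exact (hNfin w hw).2
    · exact Nat.mul_le_mul_right d hBcard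
  calc _ ≤ ((Iio (a k) ∪ f '' E) ∪ ⋃ w ∈ hBfin.toFinset, f '' T.neighborSet w).ncard :=
        ncard_le_ncard hsub (((finite_Iio _).union (hE.image _)).union hUfin)
    _ ≤ ((Iio (a k)).ncard + (f '' E).ncard) + a k * d :=
        (ncard_union_le _ _).trans (add_le_add (ncard_union_le _ _) hUcard)
    _ ≤ (a k + E.ncard) + a k * d := by
        rw [ncard_image_of_injective _ hfi, ← Finset.coe_Iio, ncard_coe_finset,
          Nat.card_Iio]
    _ ≤ (a k + 1) * (a k + 1) := by
        have h1 : k ≤ a k := ha.le_apply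
        have h2 : d ≤ a k := by omega
        have h3 : E.ncard ≤ a k := by omega
        nlinarith [Nat.mul_le_mul_left (a k) h2]

theorem not_ramseyCofinite_of_not_ramseyLowerDense {T : SimpleGraph V}
    (h : ¬ RamseyLowerDense T) : ¬ RamseyCofinite T := by
  intro h'
  refine h fun C => ?_
  obtain ⟨c, f, hf⟩ := h' C
  exact ⟨c, f, lowerDensity_pos_of_cofinite hf⟩

/-- There is a copy of `T` in `H` missing only finitely many vertices. -/
def HasCofiniteCopy (T : SimpleGraph V) (H : SimpleGraph ℕ) : Prop :=
  ∃ φ : SimpleGraph.Copy T H, (range φ)ᶜ.Finite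

theorem HasCofiniteCopy.of_subset {T : SimpleGraph V} {H : SimpleGraph ℕ} {A : Set ℕ}
    (hA : Aᶜ.Finite) (h : ∃ φ : SimpleGraph.Copy T H, A ⊆ range φ) : HasCofiniteCopy T H := by
  obtain ⟨φ, hφ⟩ := h
  exact ⟨φ, hA.subset (compl_subset_compl.2 hφ)⟩

/-- The leaves adjacent to `x`. -/
def leaves (T : SimpleGraph V) (x : V) : Set V :=
  {v | T.Adj x v ∧ IsLeaf T v}

theorem eq_of_mem_leaves {T : SimpleGraph V} {x l u : V} (h : l ∈ leaves T x)
    (hu : T.Adj l u) : u = x := by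
  obtain ⟨a, ha⟩ := encard_eq_one.1 h.2
  have h1 : u ∈ T.neighborSet l := hu
  have h2 : x ∈ T.neighborSet l := h.1.symm
  rw [ha, mem_singleton_iff] at h1 h2
  rw [h1, h2]

/-! ### Finite domination and selectors -/

/-- Every finite set of vertices of `P` may be discarded, and still some finite set of other
vertices of `P` dominates all but finitely many vertices of `Z`. -/
def RobustDom (H : SimpleGraph ℕ) (Z P : Set ℕ) : Prop :=
  ∀ F₀ : Set ℕ, F₀.Finite → ∃ F : Set ℕ, F.Finite ∧ F ⊆ P \ F₀ ∧
    {z ∈ Z | ∀ p ∈ F, ¬ H.Adj z p}.Finite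

theorem exists_of_not_robustDom {H G : SimpleGraph ℕ}
    (hc : ∀ u v, u ≠ v → H.Adj u v ∨ G.Adj u v) {Z P : Set ℕ} (h : ¬ RobustDom H Z P) :
    ∃ F₀ : Set ℕ, F₀.Finite ∧ ∀ F : Set ℕ, F.Finite → F ⊆ P \ F₀ →
      {z ∈ Z | ∀ p ∈ F, G.Adj z p}.Infinite := by
  simp only [RobustDom, not_forall, not_exists, not_and] at h
  obtain ⟨F₀, hF₀, h⟩ := h
  refine ⟨F₀, hF₀, fun F hF hFP => ?_⟩
  refine ((Set.Infinite.sdiff (h F hF hFP) hF)).mono ?_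
  rintro z ⟨⟨hz, hzF⟩, hzn⟩
  exact ⟨hz, fun p hp => (hc z p (fun e => hzn (e ▸ hp))).resolve_left (hzF p hp)⟩

theorem robustDom_of_infinite {H : SimpleGraph ℕ} {Z P : Set ℕ} (hP : P.Infinite)
    (h : ∀ p ∈ P, {z ∈ Z | ¬ H.Adj z p}.Finite) : RobustDom H Z P := by
  intro F₀ hF₀
  obtain ⟨p, hp, hpF⟩ := hP.exists_notMem_finite hF₀
  refine ⟨{p}, finite_singleton p, by simp [hp, hpF], ?_⟩
  simpa using h p hp

/-- `φ` sends every vertex of `Z` to a neighbour in `P`, and has finite fibres. -/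
def IsSelector (H : SimpleGraph ℕ) (Z P : Set ℕ) (φ : ℕ → ℕ) : Prop :=
  (∀ z ∈ Z, φ z ∈ P ∧ H.Adj z (φ z)) ∧ ∀ y, {z ∈ Z | φ z = y}.Finite

theorem exists_selector_of_infinite {H : SimpleGraph ℕ} {Z P : Set ℕ}
    (h : ∀ z ∈ Z, (H.neighborSet z ∩ P).Infinite) : ∃ φ, IsSelector H Z P φ := by
  have h' : ∀ z, ∃ p, z ∈ Z → z < p ∧ p ∈ P ∧ H.Adj z p := by
    intro z
    by_cases hz : z ∈ Z
    · obtain ⟨p, hp, hzp⟩ := (h z hz).exists_gt z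
      exact ⟨p, fun _ => ⟨hzp, hp.2, hp.1⟩⟩
    · exact ⟨0, fun hz' => absurd hz' hz⟩
  choose φ hφ using h'
  refine ⟨φ, fun z hz => (hφ z hz).2, fun y => (finite_Iio y).subset ?_⟩
  rintro z ⟨hz, rfl⟩
  exact (hφ z hz).1

theorem exists_selector_of_seq {H : SimpleGraph ℕ} {Z : Set ℕ} {F : ℕ → Set ℕ}
    (hdisj : Pairwise fun i j => Disjoint (F i) (F j))
    (hdom : ∀ i, {z ∈ Z | ∀ p ∈ F i, ¬ H.Adj z p}.Finite) :
    ∃ Z' ⊆ Z, (Z \ Z').Finite ∧ ∃ φ, IsSelector H Z' (⋃ i, F i) φ := by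
  let D : ℕ → ℕ → Prop := fun z i => ∃ p ∈ F i, H.Adj z p
  have hDfin : ∀ i, {z ∈ Z | ¬ D z i}.Finite := by
    intro i
    convert hdom i using 4
    simp [D]
  have key : ∀ z, ∃ p, D z 0 → ∃ i, p ∈ F i ∧ H.Adj z p ∧ (i = z ∨ ¬ D z (i + 1)) := by
    intro z
    by_cases h0 : D z 0
    · obtain ⟨i, hi, hi'⟩ : ∃ i, D z i ∧ (i = z ∨ ¬ D z (i + 1)) := by
        by_contra hno
        push Not at hno
        have : ∀ i, D z i := fun i => by
          induction i with
          | zero => exact h0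
          | succ i ih => exact (hno i ih).2
        exact (hno z (this z)).1 rfl
      obtain ⟨p, hp, hzp⟩ := hi
      exact ⟨p, fun _ => ⟨i, hp, hzp, hi'⟩⟩
    · exact ⟨0, fun h => absurd h h0⟩
  choose φ hφ using key
  refine ⟨{z ∈ Z | D z 0}, fun z hz => hz.1, (hDfin 0).subset ?_, φ, ?_, ?_⟩
  · rintro z ⟨hz, hz'⟩
    exact ⟨hz, fun h => hz' ⟨hz, h⟩⟩
  · rintro z ⟨_, hz⟩
    obtain ⟨i, h1, h2, _⟩ := hφ z hz
    exact ⟨mem_iUnion_of_mem i h1, h2⟩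
  · intro y
    by_cases hy : ∃ i, y ∈ F i
    · obtain ⟨i, hi⟩ := hy
      refine ((finite_singleton i).union (hDfin (i + 1))).subset ?_
      rintro z ⟨⟨hz, hz0⟩, rfl⟩
      obtain ⟨j, h1, _, h3⟩ := hφ z hz0
      have hji : j = i := by
        by_contra hne
        exact (disjoint_left.1 (hdisj hne)) h1 hi
      subst hji
      rcases h3 with h3 | h3
      · exact Or.inl h3.symm
      · exact Or.inr ⟨hz, h3⟩
    · refine finite_empty.subset ?_
      rintro z ⟨⟨_, hz0⟩, rfl⟩
      obtain ⟨j, h1, _⟩ := hφ z hz0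
      exact (hy ⟨j, h1⟩).elim

/-- Robust domination provides two selectors with disjoint ranges. -/
theorem RobustDom.exists_selectors {H : SimpleGraph ℕ} {Z P : Set ℕ} (h : RobustDom H Z P) :
    ∃ P' : Bool → Set ℕ, Disjoint (P' true) (P' false) ∧ ∀ ε, P' ε ⊆ P ∧
      ∃ Z' ⊆ Z, (Z \ Z').Finite ∧ ∃ φ, IsSelector H Z' (P' ε) φ := by
  choose g hg1 hg2 hg3 using h
  let U : ℕ → {A : Set ℕ // A.Finite} := fun n =>
    Nat.rec ⟨∅, finite_empty⟩ (fun _ A => ⟨A.1 ∪ g A.1 A.2, A.2.union (hg1 _ _)⟩) n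
  let F : ℕ → Set ℕ := fun n => g (U n).1 (U n).2
  have hU : ∀ n, (U (n + 1)).1 = (U n).1 ∪ F n := fun n => rfl
  have hUmono : ∀ m n, m ≤ n → (U m).1 ⊆ (U n).1 := by
    intro m n hmn
    induction n, hmn using Nat.le_induction with
    | base => exact Subset.rfl
    | succ n _ ih => exact ih.trans (hU n ▸ subset_union_left)
  have hlt : ∀ m n, m < n → Disjoint (F m) (F n) := by
    intro m n hmn
    rw [disjoint_left]
    intro p hp hp'
    have h1 : p ∈ (U (m + 1)).1 := by rw [hU]; exact Or.inr hp
    exact (hg2 _ (U n).2 hp').2 (hUmono _ _ hmn h1)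
  have hdisj : Pairwise fun i j => Disjoint (F i) (F j) := by
    intro i j hij
    rcases lt_or_gt_of_ne hij with h | h
    · exact hlt i j h
    · exact (hlt j i h).symm
  let o : Bool → ℕ := fun ε => if ε then 0 else 1
  refine ⟨fun ε => ⋃ i, F (2 * i + o ε), ?_, fun ε => ⟨?_, ?_⟩⟩
  · simp only [disjoint_iUnion_left, disjoint_iUnion_right]
    intro i j
    refine hdisj (i := 2 * j + o true) (j := 2 * i + o false) ?_
    simp only [o, if_true, Bool.false_eq_true, if_false]
    omega
  · exact iUnion_subset fun i => (hg2 _ _).trans sdiff_subset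
  · refine exists_selector_of_seq (fun i j hij => hdisj (by omega)) (fun i => hg3 _ _)

/-- A countable family of infinite sets of natural numbers can be split. -/
theorem exists_strictMono_mem {J : ℕ → Set ℕ} (hJ : ∀ k, (J k).Infinite) :
    ∃ x : ℕ → ℕ, StrictMono x ∧ ∀ k, x k ∈ J k := by
  choose g hg1 hg2 using fun k n => (hJ k).exists_gt n
  let x : ℕ → ℕ := fun k => Nat.rec (g 0 0) (fun k y => g (k + 1) y) k
  refine ⟨x, strictMono_nat_of_lt_succ fun k => hg2 (k + 1) (x k), fun k => ?_⟩
  cases k with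
  | zero => exact hg1 0 0
  | succ k => exact hg1 (k + 1) (x k)

theorem exists_splitting {𝒞 : Set (Set ℕ)} (h𝒞 : 𝒞.Countable) (hinf : ∀ I ∈ 𝒞, I.Infinite) :
    ∃ K : Set ℕ, ∀ I ∈ 𝒞, (I ∩ K).Infinite ∧ (I ∩ Kᶜ).Infinite := by
  rcases 𝒞.eq_empty_or_nonempty with rfl | hne
  · exact ⟨∅, by simp⟩
  obtain ⟨e, rfl⟩ := h𝒞.exists_eq_range hne
  obtain ⟨x, hx, hxJ⟩ := exists_strictMono_mem (J := fun k => e (Nat.unpair (k / 2)).1)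
    (fun k => hinf _ ⟨_, rfl⟩)
  refine ⟨{n | ∃ k, n = x (2 * k)}, ?_⟩
  rintro _ ⟨i, rfl⟩
  have hinj : Function.Injective fun m => Nat.pair i m := fun a b h => (Nat.pair_eq_pair.1 h).2
  constructor
  · refine (infinite_range_of_injective (f := fun m => x (2 * Nat.pair i m)) ?_).mono ?_
    · intro a b h
      have := hx.injective h
      exact hinj (show Nat.pair i a = Nat.pair i b by omega)
    · rintro _ ⟨m, rfl⟩
      refine ⟨?_, _, rfl⟩
      simpa using hxJ (2 * Nat.pair i m)
  · refine (infinite_range_of_injective (f := fun m => x (2 * Nat.pair i m + 1)) ?_).mono ?_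
    · intro a b h
      have := hx.injective h
      exact hinj (show Nat.pair i a = Nat.pair i b by omega)
    · rintro _ ⟨m, rfl⟩
      refine ⟨?_, ?_⟩
      · have := hxJ (2 * Nat.pair i m + 1)
        rwa [show (2 * Nat.pair i m + 1) / 2 = Nat.pair i m by omega, Nat.unpair_pair] at this
      · rintro ⟨k, hk⟩
        have := hx.injective hk
        omega

/-! ### Partial embeddings with prescribed common neighbours -/

/-- A finite partial embedding. -/
structure PState (T : SimpleGraph V) (H : SimpleGraph ℕ) (S : Set V) (f : V → ℕ) : Prop where
  fin : S.Finite
  inj : InjOn f S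
  adj : ∀ u ∈ S, ∀ v ∈ S, T.Adj u v → H.Adj (f u) (f v)

theorem PState.empty {T : SimpleGraph V} {H : SimpleGraph ℕ} (f : V → ℕ) : PState T H ∅ f :=
  ⟨finite_empty, by simp, by simp⟩

theorem PState.add {T : SimpleGraph V} {H : SimpleGraph ℕ} {S : Set V} {f : V → ℕ}
    (h : PState T H S f) {v : V} (hv : v ∉ S) {n : ℕ} (hn : n ∉ f '' S)
    (hadj : ∀ u ∈ S, T.Adj v u → H.Adj n (f u)) :
    ∃ f', PState T H (insert v S) f' ∧ (∀ u ∈ S, f' u = f u) ∧ f' v = n := by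
  classical
  have hS : ∀ u ∈ S, Function.update f v n u = f u := fun u hu =>
    Function.update_of_ne (ne_of_mem_of_not_mem hu hv) _ _
  have hvn : Function.update f v n v = n := Function.update_self ..
  refine ⟨Function.update f v n, ⟨h.fin.insert v, ?_, ?_⟩, hS, hvn⟩
  · rw [injOn_insert hv, image_congr hS, hvn]
    exact ⟨h.inj.congr fun u hu => (hS u hu).symm, hn⟩
  · rintro u (rfl | hu) w (rfl | hw) huw
    · exact absurd huw (T.loopless.irrefl _)
    · rw [hvn, hS w hw]
      exact hadj w hw huw
    · rw [hvn, hS u hu]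
      exact (hadj u hu huw.symm).symm
    · rw [hS u hu, hS w hw]
      exact h.adj u hu w hw huw

/-- Repeatedly placing fresh vertices of `L` covers any finite set `A` not larger than `L`. -/
theorem cover_finite {P : Set V → (V → ℕ) → Prop} {A : Set ℕ} (hA : A.Finite) :
    ∀ {L : Set V}, A.encard ≤ L.encard →
    (∀ S f n l, P S f → l ∈ L → l ∉ S → n ∈ A → n ∉ f '' S →
      ∃ f', P (insert l S) f' ∧ (∀ u ∈ S, f' u = f u) ∧ f' l = n) →
    ∀ {S : Set V} {f : V → ℕ}, P S f → Disjoint L S →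
    ∃ S' f', P S' f' ∧ Extends S f S' f' ∧ f' '' S' = f '' S ∪ A := by
  induction A, hA using Set.Finite.induction_on with
  | empty =>
    intro L _ _ S f h _
    exact ⟨S, f, h, Extends.refl _ _, by simp⟩
  | @insert n A hn hA ih =>
    intro L hL step S f h hLS
    have hne : L.Nonempty := by
      rw [← encard_pos]
      refine lt_of_lt_of_le ?_ hL
      rw [encard_pos]
      exact insert_nonempty _ _
    obtain ⟨l, hl⟩ := hne
    have hcard : A.encard ≤ (L \ {l}).encard := by
      rw [encard_insert_of_notMem hn, ← encard_sdiff_singleton_add_one hl] at hL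
      exact (ENat.add_le_add_iff_right (by decide)).1 hL
    have step' : ∀ S f n l', P S f → l' ∈ L \ {l} → l' ∉ S → n ∈ A → n ∉ f '' S →
        ∃ f', P (insert l' S) f' ∧ (∀ u ∈ S, f' u = f u) ∧ f' l' = n :=
      fun S f m l' h1 h2 h3 h4 h5 => step S f m l' h1 h2.1 h3 (mem_insert_of_mem _ h4) h5
    by_cases hnS : n ∈ f '' S
    · obtain ⟨S', f', k1, k2, k3⟩ := ih hcard step' h (hLS.mono_left sdiff_subset)
      refine ⟨S', f', k1, k2, ?_⟩
      rw [k3, union_insert, insert_eq_of_mem (mem_union_left A hnS)]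
    · obtain ⟨f1, h1, h2, h3⟩ := step S f n l h hl (disjoint_left.1 hLS hl) (mem_insert _ _) hnS
      obtain ⟨S', f', k1, k2, k3⟩ := ih hcard step' h1 (by
        rw [disjoint_left]
        rintro x ⟨hx, hxl⟩ (hx' | hx')
        · exact hxl hx'
        · exact disjoint_left.1 hLS hx hx')
      refine ⟨S', f', k1, Extends.trans ⟨subset_insert _ _, h2⟩ k2, ?_⟩
      rw [k3, image_insert_of_eq h2, h3, union_insert, insert_union]

theorem copy_of_bipartite [Countable V] {T : SimpleGraph V} {H : SimpleGraph ℕ}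
    (col : V → Bool) (hcol : ∀ u v, T.Adj u v → col v = !col u)
    (hfar : ∀ S : Set V, S.Finite → ∀ ε, ∃ x, col x = ε ∧ x ∉ S ∧ ∀ s ∈ S, ¬ T.Adj x s)
    (X : Bool → Set ℕ)
    (hX : ∀ ε, ∀ F : Set ℕ, F.Finite → F ⊆ X ε → {z ∈ X !ε | ∀ p ∈ F, H.Adj z p}.Infinite) :
    ∃ φ : SimpleGraph.Copy T H, (⋃ ε, X ε) ⊆ range φ := by
  refine exists_copy (fun S f => PState T H S f ∧ ∀ v ∈ S, f v ∈ X (col v))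
    ⟨∅, fun _ => 0, PState.empty _, by simp⟩ (fun S f h => h.1.inj) (fun S f h => h.1.adj) ?_ ?_
  · rintro S f ⟨h1, h2⟩ v hv
    obtain ⟨n, ⟨hn, hn'⟩, hnS⟩ := (hX (!col v) (f '' {u ∈ S | T.Adj v u})
      ((h1.fin.subset (sep_subset _ _)).image f) (by
        rintro _ ⟨u, ⟨hu, hvu⟩, rfl⟩
        exact hcol v u hvu ▸ h2 u hu)).exists_notMem_finite (h1.fin.image f)
    obtain ⟨f', k1, k2, k3⟩ := h1.add hv hnS
      (fun u hu huv => hn' _ ⟨u, ⟨hu, huv⟩, rfl⟩)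
    refine ⟨_, f', ⟨k1, ?_⟩, ⟨subset_insert _ _, k2⟩, mem_insert _ _⟩
    rintro u (rfl | hu)
    · rw [k3]
      simpa using hn
    · rw [k2 u hu]
      exact h2 u hu
  · rintro S f ⟨h1, h2⟩ n hn hnS
    obtain ⟨ε, hε⟩ := mem_iUnion.1 hn
    obtain ⟨x, hxε, hxS, hx⟩ := hfar S h1.fin ε
    obtain ⟨f', k1, k2, k3⟩ := h1.add hxS hnS (fun u hu huv => absurd huv (hx u hu))
    refine ⟨_, f', ⟨k1, ?_⟩, ⟨subset_insert _ _, k2⟩, x, mem_insert _ _, k3⟩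
    rintro u (rfl | hu)
    · rw [k3, hxε]
      exact hε
    · rw [k2 u hu]
      exact h2 u hu

/-- Copies covering a linked set `R`, in which moreover the vertices of `Z` are covered by leaves
attached to their images under a selector. -/
theorem copy_of_linked [Countable V] {T : SimpleGraph V} {H : SimpleGraph ℕ} {R Z : Set ℕ}
    {φ : ℕ → ℕ} (hφ : IsSelector H Z R φ) (hZR : Disjoint Z R)
    (hR : ∀ F : Set ℕ, F.Finite → F ⊆ R → {z ∈ R \ φ '' Z | ∀ p ∈ F, H.Adj z p}.Infinite)
    (hfar : ∀ S : Set V, S.Finite → ∀ n : ℕ, ∃ x ∉ S, (∀ s ∈ S, ¬ T.Adj x s) ∧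
      (n : ℕ∞) ≤ (leaves T x).encard) :
    ∃ ψ : SimpleGraph.Copy T H, R ∪ Z ⊆ range ψ := by
  set Fib : ℕ → Set ℕ := fun y => {z ∈ Z | φ z = y} with hFib
  set Q : Set V → (V → ℕ) → Prop := fun S f => PState T H S f ∧
    (∀ s ∈ S, f s ∈ R ∨ T.neighborSet s ⊆ S) with hQ
  have covR : ∀ S f, Q S f → FibClosed Fib (f '' S) → ∀ y ∈ R, y ∉ f '' S →
      ∃ S' f', (Q S' f' ∧ FibClosed Fib (f' '' S')) ∧ Extends S f S' f' ∧ y ∈ f' '' S' := by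
    rintro S f ⟨h1, h2⟩ h3 y hy hyS
    obtain ⟨x, hxS, hx, hxL⟩ := hfar S h1.fin (Fib y).ncard
    have hFfin : (Fib y).Finite := hφ.2 y
    rw [hFfin.cast_ncard_eq] at hxL
    obtain ⟨f1, k1, k2, k3⟩ := h1.add hxS hyS (fun u hu huv => absurd huv (hx u hu))
    obtain ⟨S', f', ⟨m1, m2, m3⟩, m4, m5⟩ := cover_finite
      (P := fun S f => Q S f ∧ x ∈ S ∧ f x = y) hFfin hxL (by
        rintro S f n l ⟨⟨g1, g2⟩, g3, g4⟩ hl hlS hn hnS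
        obtain ⟨f', j1, j2, j3⟩ := g1.add hlS hnS (by
          intro u hu hlu
          rw [eq_of_mem_leaves hl hlu, g4, ← hn.2]
          exact (hφ.1 n hn.1).2)
        refine ⟨f', ⟨⟨j1, ?_⟩, mem_insert_of_mem _ g3, by rw [j2 x g3, g4]⟩, j2, j3⟩
        rintro s (rfl | hs)
        · right
          intro u hu
          rw [eq_of_mem_leaves hl hu]
          exact mem_insert_of_mem _ g3
        · rw [j2 s hs]
          exact (g2 s hs).imp_right fun h => h.trans (subset_insert _ _))
      (S := insert x S) (f := f1) ⟨⟨k1, by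
        rintro s (rfl | hs)
        · left
          rwa [k3]
        · rw [k2 s hs]
          exact (h2 s hs).imp_right fun h => h.trans (subset_insert _ _)⟩, mem_insert _ _, k3⟩ (by
        rw [disjoint_left]
        rintro l hl (rfl | hlS)
        · exact T.loopless.irrefl _ hl.1
        · exact hx l hlS hl.1)
    refine ⟨S', f', ⟨m1, ?_⟩, Extends.trans ⟨subset_insert _ _, k2⟩ m4, x, m2, m3⟩
    rw [m5, image_insert_of_eq k2, k3]
    rintro w ((rfl | hw) | hw)
    · exact subset_union_right
    · exact (h3 w hw).trans ((subset_insert _ _).trans subset_union_left)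
    · rintro z ⟨hz, rfl⟩
      exact (disjoint_left.1 hZR hw.1 (hφ.1 z hz).1).elim
  refine exists_copy (fun S f => Q S f ∧ FibClosed Fib (f '' S))
    ⟨∅, fun _ => 0, ⟨PState.empty _, by simp⟩, by simp [FibClosed]⟩ (fun S f h => h.1.1.inj)
    (fun S f h => h.1.1.adj) ?_ ?_
  · rintro S f ⟨⟨h1, h2⟩, h3⟩ v hv
    obtain ⟨n, ⟨hn, hn'⟩, hnS⟩ := (hR (f '' {u ∈ S | T.Adj v u})
      ((h1.fin.subset (sep_subset _ _)).image f) (by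
        rintro _ ⟨u, ⟨hu, hvu⟩, rfl⟩
        exact (h2 u hu).resolve_right fun h => hv (h hvu.symm))).exists_notMem_finite
          (h1.fin.image f)
    obtain ⟨f', k1, k2, k3⟩ := h1.add hv hnS
      (fun u hu huv => hn' _ ⟨u, ⟨hu, huv⟩, rfl⟩)
    refine ⟨_, f', ⟨⟨k1, ?_⟩, ?_⟩, ⟨subset_insert _ _, k2⟩, mem_insert _ _⟩
    · rintro u (rfl | hu)
      · rw [k3]
        exact Or.inl hn.1
      · rw [k2 u hu]
        exact (h2 u hu).imp_right fun h => h.trans (subset_insert _ _)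
    · rw [image_insert_of_eq k2, k3]
      refine h3.insert ?_
      rw [eq_empty_iff_forall_notMem]
      rintro z ⟨hz, hzn⟩
      exact hn.2 ⟨z, hz, hzn⟩
  · rintro S f ⟨h1, h2⟩ n hn hnS
    rcases hn with hn | hn
    · exact covR S f h1 h2 n hn hnS
    · by_cases hy : φ n ∈ f '' S
      · exact absurd (h2 _ hy ⟨hn, rfl⟩) hnS
      · obtain ⟨S', f', ⟨k1, k2⟩, k3, k4⟩ := covR S f h1 h2 (φ n) (hφ.1 n hn).1 hy
        exact ⟨S', f', ⟨k1, k2⟩, k3, k2 _ k4 ⟨hn, rfl⟩⟩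

/-! ### Ultrafilters -/

theorem exists_free_ultrafilter : ∃ U : Ultrafilter ℕ, ∀ s ∈ U, s.Infinite :=
  ⟨hyperfilter ℕ, fun _ hs hfin => hfin.notMem_hyperfilter hs⟩

theorem common_mem {U : Ultrafilter ℕ} {H : SimpleGraph ℕ} {F : Set ℕ} (hF : F.Finite)
    (h : ∀ p ∈ F, H.neighborSet p ∈ U) : {z | ∀ p ∈ F, H.Adj z p} ∈ U := by
  have : {z | ∀ p ∈ F, H.Adj z p} = ⋂ p ∈ F, H.neighborSet p := by
    ext z
    simp [SimpleGraph.adj_comm]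
  rw [this]
  exact (biInter_mem hF).2 h

theorem neighborSet_mem_or {U : Ultrafilter ℕ} (hU : ∀ s ∈ U, s.Infinite) {H G : SimpleGraph ℕ}
    (hc : ∀ u v, u ≠ v → H.Adj u v ∨ G.Adj u v) (v : ℕ) :
    H.neighborSet v ∈ U ∨ G.neighborSet v ∈ U := by
  have h1 : {v}ᶜ ∈ U := by
    rw [Ultrafilter.compl_mem_iff_notMem]
    exact fun h => hU _ h (finite_singleton v)
  rw [← Ultrafilter.union_mem_iff]
  refine mem_of_superset h1 fun w hw => hc v w fun e => hw e.symm

/-- The case of robustly undominated bipartite pairs. -/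
theorem hasCofiniteCopy_of_not_robustDom [Countable V] {T : SimpleGraph V} {H G : SimpleGraph ℕ}
    (hc : ∀ u v, u ≠ v → H.Adj u v ∨ G.Adj u v) {U : Ultrafilter ℕ} (hU : ∀ s ∈ U, s.Infinite)
    {B R : Set ℕ} (hR : R ∈ U) (hB : ∀ b ∈ B, G.neighborSet b ∈ U) (hBR : (B ∪ R)ᶜ.Finite)
    (col : V → Bool) (hcol : ∀ u v, T.Adj u v → col v = !col u)
    (hfar : ∀ S : Set V, S.Finite → ∀ ε, ∃ x, col x = ε ∧ x ∉ S ∧ ∀ s ∈ S, ¬ T.Adj x s)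
    (h : ¬ RobustDom H B R) : HasCofiniteCopy T G := by
  obtain ⟨F₀, hF₀, hF⟩ := exists_of_not_robustDom hc h
  have hRU : R \ F₀ ∈ U := by
    rw [sdiff_eq]
    refine inter_mem hR ?_
    rw [Ultrafilter.mem_coe, Ultrafilter.compl_mem_iff_notMem]
    exact fun h => hU _ h hF₀
  refine HasCofiniteCopy.of_subset ?_
    (copy_of_bipartite col hcol hfar (fun ε => if ε then B else R \ F₀) ?_)
  · refine (hBR.union hF₀).subset ?_
    intro n hn
    by_contra hno
    rw [mem_union, not_or, mem_compl_iff, not_not] at hno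
    refine hn (mem_iUnion.2 ?_)
    rcases hno.1 with h' | h'
    · exact ⟨true, by simpa using h'⟩
    · exact ⟨false, by simpa using ⟨h', hno.2⟩⟩
  · rintro (_ | _) F hFfin hFX
    · simpa using hF F hFfin (by simpa using hFX)
    · simp only [if_true] at hFX
      exact hU _ (inter_mem hRU (common_mem hFfin fun p hp => hB p (hFX hp)))

theorem exists_bool_coloring {T : SimpleGraph V} (hT : T.IsAcyclic) :
    ∃ col : V → Bool, ∀ u v, T.Adj u v → col v = !col u := by
  obtain ⟨C⟩ := hT.colorable_two
  refine ⟨fun v => C v = 0, fun u v h => ?_⟩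
  have := C.valid h
  have h1 : C u = 0 ∨ C u = 1 := by omega
  have h2 : C v = 0 ∨ C v = 1 := by omega
  rcases h1 with h1 | h1 <;> rcases h2 with h2 | h2 <;> simp_all

/-- One of two complementary graphs contains a set in a free ultrafilter all of whose finite
subsets have common neighbours in it. -/
theorem exists_linked_or {H G : SimpleGraph ℕ} (hc : ∀ u v, u ≠ v → H.Adj u v ∨ G.Adj u v)
    {U : Ultrafilter ℕ} (hU : ∀ s ∈ U, s.Infinite) :
    {v | H.neighborSet v ∈ U} ∈ U ∨ {v | G.neighborSet v ∈ U} ∈ U := by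
  rw [← Ultrafilter.union_mem_iff]
  exact univ_mem' fun v => neighborSet_mem_or hU hc v

/-- Forests with large pendant stars far from every finite set. -/
theorem hasCofiniteCopy_of_far_stars [Countable V] {T : SimpleGraph V} (hT : T.IsAcyclic)
    (hfar : ∀ S : Set V, S.Finite → ∀ n : ℕ, ∃ x ∉ S, (∀ s ∈ S, ¬ T.Adj x s) ∧
      (n : ℕ∞) ≤ (leaves T x).encard)
    {H G : SimpleGraph ℕ} (hc : ∀ u v, u ≠ v → H.Adj u v ∨ G.Adj u v)
    {U : Ultrafilter ℕ} (hU : ∀ s ∈ U, s.Infinite) (hR : {v | H.neighborSet v ∈ U} ∈ U) :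
    HasCofiniteCopy T H ∨ HasCofiniteCopy T G := by
  set R := {v | H.neighborSet v ∈ U} with hRdef
  by_cases hD : RobustDom H Rᶜ R
  · left
    obtain ⟨P', hP', hsel⟩ := hD.exists_selectors
    obtain ⟨ε, hε⟩ : ∃ ε, P' ε ∉ U := by
      by_contra hno
      push Not at hno
      have := inter_mem (hno true) (hno false)
      rw [disjoint_iff_inter_eq_empty.1 hP'] at this
      exact hU _ this finite_empty
    obtain ⟨hPR, Z, hZR, hZfin, φ, hφ⟩ := hsel ε
    refine HasCofiniteCopy.of_subset ?_ (copy_of_linked (R := R) (Z := Z) (φ := φ)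
      ⟨fun z hz => ⟨hPR (hφ.1 z hz).1, (hφ.1 z hz).2⟩, hφ.2⟩
      (disjoint_compl_left.mono_left hZR) ?_ hfar)
    · refine hZfin.subset fun n hn => ?_
      simp only [mem_compl_iff, mem_union, not_or] at hn
      exact ⟨hn.1, hn.2⟩
    · intro F hF hFR
      have h1 : R \ φ '' Z ∈ U := by
        rw [sdiff_eq]
        refine inter_mem hR ?_
        rw [Ultrafilter.mem_coe, Ultrafilter.compl_mem_iff_notMem]
        refine fun h => hε (mem_of_superset h ?_)
        rintro _ ⟨z, hz, rfl⟩
        exact (hφ.1 z hz).1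
      exact hU _ (inter_mem h1 (common_mem hF fun p hp => hFR hp))
  · right
    obtain ⟨col, hcol⟩ := exists_bool_coloring hT
    refine hasCofiniteCopy_of_not_robustDom hc hU hR (B := Rᶜ)
      (fun b hb => (neighborSet_mem_or hU hc b).resolve_left hb) (by simp) col hcol ?_ hD
    intro S hS ε
    obtain ⟨x, hxS, hx, hxL⟩ := hfar S hS (S.ncard + 1)
    by_cases hxε : col x = ε
    · exact ⟨x, hxε, hxS, hx⟩
    · obtain ⟨l, hl, hlS⟩ : ∃ l ∈ leaves T x, l ∉ S := by
        by_contra hno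
        push Not at hno
        have h1 := hxL.trans (encard_le_encard (show leaves T x ⊆ S from hno))
        rw [← hS.cast_ncard_eq] at h1
        have : S.ncard + 1 ≤ S.ncard := by exact_mod_cast h1
        omega
      refine ⟨l, ?_, hlS, fun s hs hls => ?_⟩
      · rw [hcol x l hl.1]
        revert hxε
        cases col x <;> cases ε <;> simp
      · rw [eq_of_mem_leaves hl hls] at hs
        exact hxS hs

/-- Graphs with infinitely many isolated vertices. -/
theorem hasCofiniteCopy_of_isolated [Countable V] {T : SimpleGraph V}
    (hI : {v | T.neighborSet v = ∅}.Infinite) {H : SimpleGraph ℕ} {U : Ultrafilter ℕ}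
    (hU : ∀ s ∈ U, s.Infinite) (hR : {v | H.neighborSet v ∈ U} ∈ U) : HasCofiniteCopy T H := by
  set R := {v | H.neighborSet v ∈ U} with hRdef
  refine HasCofiniteCopy.of_subset (A := univ) (by simp) ?_
  refine exists_copy (fun S f => PState T H S f ∧ ∀ v ∈ S, T.neighborSet v = ∅ ∨ f v ∈ R)
    ⟨∅, fun _ => 0, PState.empty _, by simp⟩ (fun S f h => h.1.inj) (fun S f h => h.1.adj) ?_ ?_
  · rintro S f ⟨h1, h2⟩ v hv
    obtain ⟨n, ⟨hn, hn'⟩, hnS⟩ := (hU _ (inter_mem hR (common_mem (H := H)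
      (F := f '' {u ∈ S | T.Adj v u}) ((h1.fin.subset (sep_subset _ _)).image f) (by
        rintro _ ⟨u, ⟨hu, hvu⟩, rfl⟩
        refine (h2 u hu).resolve_left fun h => ?_
        have : v ∈ T.neighborSet u := hvu.symm
        rw [h] at this
        exact this)))).exists_notMem_finite (h1.fin.image f)
    obtain ⟨f', k1, k2, k3⟩ := h1.add hv hnS
      (fun u hu huv => hn' _ ⟨u, ⟨hu, huv⟩, rfl⟩)
    refine ⟨_, f', ⟨k1, ?_⟩, ⟨subset_insert _ _, k2⟩, mem_insert _ _⟩
    rintro u (rfl | hu)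
    · rw [k3]
      exact Or.inr hn
    · rw [k2 u hu]
      exact h2 u hu
  · rintro S f ⟨h1, h2⟩ n - hnS
    obtain ⟨x, hx, hxS⟩ := hI.exists_notMem_finite h1.fin
    have hx' : ∀ u, ¬ T.Adj x u := fun u hu => by
      have h3 : u ∈ T.neighborSet x := hu
      rw [show T.neighborSet x = ∅ from hx] at h3
      exact h3
    obtain ⟨f', k1, k2, k3⟩ := h1.add hxS hnS (fun u _ huv => absurd huv (hx' u))
    refine ⟨_, f', ⟨k1, ?_⟩, ⟨subset_insert _ _, k2⟩, x, mem_insert _ _, k3⟩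
    rintro u (rfl | hu)
    · exact Or.inl hx
    · rw [k2 u hu]
      exact h2 u hu

section Rooted

variable {T : SimpleGraph V} {ρ : Rooting T} {H G : SimpleGraph ℕ} {W : Set ℕ} {S : Set V}
  {f : V → ℕ}

theorem Rooting.par_of_adj {s v : V} (ρ : Rooting T) (hs : ρ.par s = none) (h : T.Adj s v) :
    ρ.par v = some s := by
  rcases (ρ.adj_iff s v).1 h with h' | h'
  · rw [hs] at h'
    cases h'
  · exact h'

theorem Rooting.adj_of_par {u v : V} (ρ : Rooting T) (h : ρ.par v = some u) : T.Adj u v :=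
  (ρ.adj_iff u v).2 (Or.inr h)

theorem Rooting.par_ne_of_leaf {x l : V} (ρ : Rooting T) (hl : l ∈ leaves T x)
    (h : ρ.par l = some x) (u : V) : ρ.par u ≠ some l := by
  intro hu
  have hux := eq_of_mem_leaves hl (ρ.adj_of_par hu)
  subst hux
  have h1 := ρ.dep_par _ _ h
  have h2 := ρ.dep_par _ _ hu
  omega

theorem Rooting.exists_child {u p : V} (ρ : Rooting T) (hp : ρ.par p = some u)
    (hl : ¬ IsLeaf T p) : ∃ q, ρ.par q = some p := by
  by_contra hno
  push Not at hno
  refine hl (encard_eq_one.2 ⟨u, ?_⟩)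
  ext v
  simp only [SimpleGraph.mem_neighborSet, mem_singleton_iff]
  constructor
  · intro h
    rcases (ρ.adj_iff p v).1 h with h' | h'
    · rw [hp, Option.some.injEq] at h'
      exact h'.symm
    · exact absurd h' (hno v)
  · rintro rfl
    exact (ρ.adj_of_par hp).symm

theorem Rooting.exists_chain (ρ : Rooting T) (v : V) : ∃ (k : ℕ) (c : ℕ → V), c k = v ∧
    ρ.par (c 0) = none ∧ ∀ i < k, ρ.par (c (i + 1)) = some (c i) := by
  obtain ⟨d, hd⟩ : ∃ d, ρ.dep v = d := ⟨_, rfl⟩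
  induction d using Nat.strong_induction_on generalizing v with
  | _ d ih =>
  cases hp : ρ.par v with
  | none => exact ⟨0, fun _ => v, rfl, hp, by simp⟩
  | some u =>
    obtain ⟨k, c, h1, h2, h3⟩ := ih (ρ.dep u) (by have := ρ.dep_par v u hp; omega) u rfl
    refine ⟨k + 1, fun i => if i ≤ k then c i else v, by simp, by simpa using h2, ?_⟩
    intro i hi
    rcases Nat.lt_succ_iff_lt_or_eq.1 hi with hi | rfl
    · simp only [show i + 1 ≤ k from hi, if_true, hi.le]
      exact h3 i hi
    · simp [h1, hp]

theorem Rooting.injOn_chain (ρ : Rooting T) {k : ℕ} {c : ℕ → V}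
    (h : ∀ i < k, ρ.par (c (i + 1)) = some (c i)) {i j : ℕ} (hij : i < j) (hj : j ≤ k) :
    c i ≠ c j := by
  have hdep : ∀ j ≤ k, ρ.dep (c j) = ρ.dep (c 0) + j := by
    intro j hj
    induction j with
    | zero => rfl
    | succ j ih => rw [ρ.dep_par _ _ (h j hj), ih (by omega)]; rfl
  intro e
  have h1 := hdep i (by omega)
  have h2 := hdep j hj
  rw [e] at h1
  omega

theorem Rooting.reachable_chain (ρ : Rooting T) {k : ℕ} {c : ℕ → V}
    (h : ∀ i < k, ρ.par (c (i + 1)) = some (c i)) : ∀ j ≤ k, T.Reachable (c 0) (c j) := by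
  intro j hj
  induction j with
  | zero => exact SimpleGraph.Reachable.refl _
  | succ j ih => exact (ih (by omega)).trans (ρ.adj_of_par (h j hj)).reachable

theorem RState.root {s : V} (hs : ρ.par s = none) {a : ℕ} (ha : a ∈ W) :
    RState ρ H W {s} (fun _ => a) := by
  refine ⟨finite_singleton s, ?_, injOn_singleton _ _, ?_, fun _ _ _ _ => ha⟩
  · rintro u v rfl h
    rw [hs] at h
    cases h
  · rintro u v rfl h
    rw [hs] at h
    cases h

/-- A chain of descendants of a vertex of the domain may be sent to any fresh path. -/
theorem RState.add_chain (h : RState ρ H W S f) {c : ℕ → V} {g : ℕ → ℕ} (h0 : c 0 ∈ S)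
    (hf0 : f (c 0) = g 0) : ∀ k : ℕ, (∀ i < k, ρ.par (c (i + 1)) = some (c i)) →
    (∀ i < k, c (i + 1) ∉ S) → (∀ i < k, g (i + 1) ∈ W) → (∀ i < k, g (i + 1) ∉ f '' S) →
    (∀ i < k, H.Adj (g (i + 1)) (g i)) → (∀ j ≤ k, ∀ i < j, g i ≠ g j) →
    ∃ S' f', RState ρ H W S' f' ∧ Extends S f S' f' ∧ (∀ i ≤ k, c i ∈ S' ∧ f' (c i) = g i) ∧
      ∀ v ∈ S', v ∈ S ∨ ∃ i < k, v = c (i + 1) := by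
  intro k
  induction k with
  | zero =>
    intro _ _ _ _ _ _
    refine ⟨S, f, h, Extends.refl _ _, fun i hi => ?_, fun v hv => Or.inl hv⟩
    rw [Nat.le_zero.1 hi]
    exact ⟨h0, hf0⟩
  | succ k ih =>
    intro hpar hcS hgW hgS hadj hinj
    obtain ⟨S1, f1, k1, k2, k3, k4⟩ := ih (fun i hi => hpar i (by omega))
      (fun i hi => hcS i (by omega)) (fun i hi => hgW i (by omega)) (fun i hi => hgS i (by omega))
      (fun i hi => hadj i (by omega)) (fun j hj => hinj j (by omega))
    have hnew : c (k + 1) ∉ S1 := by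
      intro hmem
      rcases k4 _ hmem with hm | ⟨i, hi, hm⟩
      · exact hcS k (by omega) hm
      · exact ρ.injOn_chain hpar (show i + 1 < k + 1 by omega) le_rfl hm.symm
    have hgnew : g (k + 1) ∉ f1 '' S1 := by
      rintro ⟨v, hv, hgv⟩
      rcases k4 v hv with hm | ⟨i, hi, rfl⟩
      · exact hgS k (by omega) ⟨v, hm, by rw [← k2.2 v hm, hgv]⟩
      · rw [(k3 (i + 1) hi).2] at hgv
        exact hinj (k + 1) le_rfl (i + 1) (by omega) hgv
    obtain ⟨f', m1, m2, m3⟩ := k1.add hnew hgnew (by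
      intro u hu
      rw [hpar k (by omega), Option.some.injEq] at hu
      subst hu
      refine ⟨(k3 k le_rfl).1, ?_⟩
      rw [(k3 k le_rfl).2]
      exact hadj k (by omega)) (fun _ _ => hgW k (by omega))
    refine ⟨_, f', m1, k2.trans ⟨subset_insert _ _, m2⟩, fun i hi => ?_, ?_⟩
    · rcases Nat.le_succ_iff.1 hi with hi | rfl
      · exact ⟨mem_insert_of_mem _ (k3 i hi).1, by rw [m2 _ (k3 i hi).1, (k3 i hi).2]⟩
      · exact ⟨mem_insert _ _, m3⟩
    · rintro v (rfl | hv)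
      · exact Or.inr ⟨k, by omega, rfl⟩
      · exact (k4 v hv).imp_right fun ⟨i, hi, e⟩ => ⟨i, by omega, e⟩

theorem RState.cover_child (h : RState ρ H W S f) {u : V} (hu : u ∈ S)
    (hinf : {v | ρ.par v = some u}.Infinite) {n : ℕ} (hn : n ∈ W) (hnS : n ∉ f '' S)
    (hadj : H.Adj (f u) n) :
    ∃ S' f', RState ρ H W S' f' ∧ Extends S f S' f' ∧ n ∈ f' '' S' := by
  obtain ⟨v, hv, hvS⟩ := hinf.exists_notMem_finite h.fin
  obtain ⟨f', k1, k2, k3⟩ := h.add hvS hnS (by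
    intro w hw
    rw [show ρ.par v = some u from hv, Option.some.injEq] at hw
    subst hw
    exact ⟨hu, hadj.symm⟩) (fun _ _ => hn)
  exact ⟨_, f', k1, ⟨subset_insert _ _, k2⟩, v, mem_insert _ _, k3⟩

theorem RState.cover_grandchild (h : RState ρ H W S f) {u : V} (hu : u ∈ S)
    (hinf : {p | ρ.par p = some u ∧ ∃ q, ρ.par q = some p}.Infinite) {m n : ℕ} (hm : m ∈ W)
    (hmS : m ∉ f '' S) (hn : n ∈ W) (hnS : n ∉ f '' S) (hum : H.Adj (f u) m)
    (hmn : H.Adj m n) :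
    ∃ S' f', RState ρ H W S' f' ∧ Extends S f S' f' ∧ n ∈ f' '' S' := by
  obtain ⟨p, ⟨hp, q, hq⟩, hpS⟩ := hinf.exists_notMem_finite h.fin
  have hqS : q ∉ S := fun hqS => hpS (h.down q p hqS hq)
  obtain ⟨S', f', k1, k2, k3, -⟩ := h.add_chain (c := fun i => if i = 0 then u else
      if i = 1 then p else q) (g := fun i => if i = 0 then f u else if i = 1 then m else n)
    (by simpa using hu) (by simp) 2 (by
      intro i hi
      interval_cases i <;> simp [hp, hq]) (by
      intro i hi
      interval_cases i <;> simp [hpS, hqS]) (by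
      intro i hi
      interval_cases i <;> simp [hm, hn]) (by
      intro i hi
      interval_cases i
      · simpa using hmS
      · simpa using hnS) (by
      intro i hi
      interval_cases i
      · simpa using hum.symm
      · simpa using hmn.symm) (by
      have e : f u ≠ n := fun e => hnS ⟨u, hu, e⟩
      intro j hj i hi
      interval_cases j <;> interval_cases i <;> simp [hum.ne, hmn.ne, e])
  exact ⟨S', f', k1, k2, q, by simpa using k3 2 le_rfl⟩

theorem RState.cover_greatgrandchild (h : RState ρ H W S f) {u : V} (hu : u ∈ S)
    (hinf : {p | ρ.par p = some u ∧ ∃ q w, ρ.par q = some p ∧ ρ.par w = some q}.Infinite)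
    {l m n : ℕ} (hl : l ∈ W) (hlS : l ∉ f '' S) (hm : m ∈ W)
    (hmS : m ∉ f '' S) (hn : n ∈ W) (hnS : n ∉ f '' S) (hul : H.Adj (f u) l)
    (hlm : H.Adj l m) (hmn : H.Adj m n) (hln : l ≠ n) :
    ∃ S' f', RState ρ H W S' f' ∧ Extends S f S' f' ∧ n ∈ f' '' S' := by
  obtain ⟨p, ⟨hp, q, w, hq, hw⟩, hpS⟩ := hinf.exists_notMem_finite h.fin
  have hqS : q ∉ S := fun hqS => hpS (h.down q p hqS hq)
  have hwS : w ∉ S := fun hwS => hqS (h.down w q hwS hw)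
  obtain ⟨S', f', k1, k2, k3, -⟩ := h.add_chain (c := fun i => if i = 0 then u else
      if i = 1 then p else if i = 2 then q else w)
    (g := fun i => if i = 0 then f u else if i = 1 then l else if i = 2 then m else n)
    (by simpa using hu) (by simp) 3 (by
      intro i hi
      interval_cases i <;> simp [hp, hq, hw]) (by
      intro i hi
      interval_cases i <;> simp [hpS, hqS, hwS]) (by
      intro i hi
      interval_cases i <;> simp [hl, hm, hn]) (by
      intro i hi
      interval_cases i
      · simpa using hlS
      · simpa using hmS
      · simpa using hnS) (by
      intro i hi
      interval_cases i
      · simpa using hul.symm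
      · simpa using hlm.symm
      · simpa using hmn.symm) (by
      have e1 : f u ≠ n := fun e => hnS ⟨u, hu, e⟩
      have e2 : f u ≠ m := fun e => hmS ⟨u, hu, e⟩
      intro j hj i hi
      interval_cases j <;> interval_cases i <;> simp [hul.ne, hlm.ne, hmn.ne, e1, e2, hln])
  exact ⟨S', f', k1, k2, w, by simpa using k3 3 le_rfl⟩

/-! ### Infinitely many large stars at the neighbours of a vertex -/

theorem copy_of_branching [Countable V] (ρ : Rooting T) {s : V} (hs : ρ.par s = none)
    (hL : ∀ n : ℕ, {x | T.Adj s x ∧ (n : ℕ∞) ≤ (leaves T x).encard}.Infinite)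
    {Gn M Z : Set ℕ} {a : ℕ} {φ : ℕ → ℕ} (ha : a ∈ W) (hGW : Gn ⊆ W)
    (hG : ∀ w ∈ W, (H.neighborSet w ∩ Gn).Infinite) (hMW : M ⊆ W) (hMa : ∀ y ∈ M, H.Adj a y)
    (hφ : IsSelector H Z M φ) (hZM : Disjoint Z M) (hGφ : ∀ z ∈ Z, φ z ∉ Gn) :
    ∃ ψ : SimpleGraph.Copy T H, M ∪ Z ⊆ range ψ := by
  set Fib : ℕ → Set ℕ := fun y => {z ∈ Z | φ z = y} with hFib
  have hcov : ∀ S f, RState ρ H W S f → FibClosed Fib (f '' S) →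
      Extends {s} (fun _ => a) S f → ∀ y ∈ M, y ∉ f '' S →
      ∃ S' f', RState ρ H W S' f' ∧ FibClosed Fib (f' '' S') ∧ Extends S f S' f' ∧
        y ∈ f' '' S' := by
    intro S f h1 h2 h3 y hy hyS
    have hsS : s ∈ S := h3.1 rfl
    have hfs : f s = a := h3.2 s rfl
    obtain ⟨x, ⟨hsx, hxL⟩, hxS⟩ := (hL (Fib y).ncard).exists_notMem_finite h1.fin
    have hFfin : (Fib y).Finite := hφ.2 y
    rw [hFfin.cast_ncard_eq] at hxL
    have hxs : ρ.par x = some s := ρ.par_of_adj hs hsx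
    have hleaf : ∀ l ∈ leaves T x, ρ.par l = some x := by
      intro l hl
      rcases (ρ.adj_iff x l).1 hl.1 with h | h
      · rw [hxs, Option.some.injEq] at h
        subst h
        obtain ⟨x', hx', hne⟩ := (hL 0).exists_notMem_finite (finite_singleton x)
        exact absurd (eq_of_mem_leaves hl hx'.1) hne
      · exact h
    obtain ⟨f1, k1, k2, k3⟩ := h1.add hxS hyS (by
      intro u hu
      rw [hxs, Option.some.injEq] at hu
      subst hu
      exact ⟨hsS, hfs ▸ (hMa y hy).symm⟩) (fun _ _ => hMW hy)
    obtain ⟨S', f', ⟨m1, m2, m3⟩, m4, m5⟩ := cover_finite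
      (P := fun S f => RState ρ H W S f ∧ x ∈ S ∧ f x = y) hFfin hxL (by
        rintro S f n l ⟨g1, g3, g4⟩ hl hlS hn hnS
        obtain ⟨f', j1, j2, j3⟩ := g1.add hlS hnS (by
          intro u hu
          rw [hleaf l hl, Option.some.injEq] at hu
          subst hu
          refine ⟨g3, ?_⟩
          rw [g4, ← hn.2]
          exact (hφ.1 n hn.1).2)
          (fun u hu => absurd hu (ρ.par_ne_of_leaf hl (hleaf l hl) u))
        exact ⟨f', ⟨j1, mem_insert_of_mem _ g3, by rw [j2 x g3, g4]⟩, j2, j3⟩)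
      (S := insert x S) (f := f1) ⟨k1, mem_insert _ _, k3⟩ (by
        rw [disjoint_left]
        rintro l hl (rfl | hlS)
        · exact T.loopless.irrefl _ hl.1
        · exact hxS (h1.down l x hlS (hleaf l hl)))
    refine ⟨S', f', m1, ?_, Extends.trans ⟨subset_insert _ _, k2⟩ m4, x, m2, m3⟩
    rw [m5, image_insert_of_eq k2, k3]
    rintro w ((rfl | hw) | hw)
    · exact subset_union_right
    · exact (h2 w hw).trans ((subset_insert _ _).trans subset_union_left)
    · rintro z ⟨hz, rfl⟩
      exact (disjoint_left.1 hZM hw.1 (hφ.1 z hz).1).elim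
  refine rooted_copy_fib ρ hGW ((hG a ha).mono inter_subset_right) hG (Fib := Fib) ?_
    (RState.root hs ha) ?_ ?_
  · intro g hg
    rw [eq_empty_iff_forall_notMem]
    rintro z ⟨hz, rfl⟩
    exact hGφ z hz hg
  · rintro y hy z ⟨hz, rfl⟩
    simp only [image_singleton, mem_singleton_iff] at hy
    have := hMa _ (hφ.1 z hz).1
    rw [hy] at this
    exact absurd this (H.loopless.irrefl _)
  · intro S f h1 h2 h3 n hn hnS
    rcases hn with hn | hn
    · exact hcov S f h1 h2 h3 n hn hnS
    · by_cases hy : φ n ∈ f '' S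
      · exact absurd (h2 _ hy ⟨hn, rfl⟩) hnS
      · obtain ⟨S', f', k1, k2, k3, k4⟩ := hcov S f h1 h2 h3 (φ n) (hφ.1 n hn).1 hy
        exact ⟨S', f', k1, k2, k3, k2 _ k4 ⟨hn, rfl⟩⟩

theorem hasCofiniteCopy_of_branching_of_cofinite_nbrs [Countable V] (hT : T.IsAcyclic) {s : V}
    (hL : ∀ n : ℕ, {x | T.Adj s x ∧ (n : ℕ∞) ≤ (leaves T x).encard}.Infinite)
    {E : Set ℕ} (hE : E.Infinite) (hEH : ∀ e ∈ E, (H.neighborSet e)ᶜ.Finite) :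
    HasCofiniteCopy T H := by
  obtain ⟨ρ, hs⟩ := exists_rooting_at hT s
  obtain ⟨K, hK⟩ := exists_splitting (𝒞 := {E}) (countable_singleton _) (by simpa using hE)
  obtain ⟨hK1, hK2⟩ := hK E rfl
  obtain ⟨a, ha⟩ := hE.nonempty
  have hcap : ∀ {A : Set ℕ} {e : ℕ}, A.Infinite → e ∈ E → (H.neighborSet e ∩ A).Infinite := by
    intro A e hA he
    refine (hA.sdiff (hEH e he)).mono ?_
    rintro x ⟨hx, hx'⟩
    exact ⟨not_not.1 hx', hx⟩
  set M := H.neighborSet a ∩ (E ∩ K) with hM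
  have hMinf : M.Infinite := hcap hK1 ha
  have hD : RobustDom H Mᶜ M := robustDom_of_infinite hMinf fun p hp =>
    (hEH p hp.2.1).subset fun z hz => fun h => hz.2 h.symm
  obtain ⟨P', -, hsel⟩ := hD.exists_selectors
  obtain ⟨hPM, Z, hZM, hZfin, φ, hφ⟩ := hsel true
  refine HasCofiniteCopy.of_subset ?_ (copy_of_branching ρ hs hL (W := E) (Gn := E ∩ Kᶜ) (M := M)
    (Z := Z) (φ := φ) ha inter_subset_left (fun w hw => hcap hK2 hw)
    (inter_subset_right.trans inter_subset_left) (fun y hy => hy.1)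
    ⟨fun z hz => ⟨hPM (hφ.1 z hz).1, (hφ.1 z hz).2⟩, hφ.2⟩
    (disjoint_compl_left.mono_left hZM) (fun z hz h => h.2 (hPM (hφ.1 z hz).1).2.2))
  refine hZfin.subset fun n hn => ?_
  rw [mem_compl_iff, mem_union, not_or] at hn
  exact ⟨hn.1, hn.2⟩

theorem hasCofiniteCopy_of_star_of_cofinite_nbrs [Countable V] (hT : T.IsAcyclic) {t : V}
    (hL : (leaves T t).Infinite)
    {E : Set ℕ} (hE : E.Infinite) (hEH : ∀ e ∈ E, (H.neighborSet e)ᶜ.Finite) :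
    HasCofiniteCopy T H := by
  obtain ⟨ρ, ht⟩ := exists_rooting_at hT t
  obtain ⟨a, ha⟩ := hE.nonempty
  refine HasCofiniteCopy.of_subset (hEH a ha) (rooted_copy ρ (W := E) hE ?_
    (RState.root ht ha) ?_)
  · intro w hw
    refine (hE.sdiff (hEH w hw)).mono ?_
    rintro x ⟨hx, hx'⟩
    exact ⟨not_not.1 hx', hx⟩
  · intro S f h1 h2 n hn hnS
    obtain ⟨l, hl, hlS⟩ := hL.exists_notMem_finite h1.fin
    have hlt := ρ.par_of_adj ht hl.1
    obtain ⟨f', k1, k2, k3⟩ := h1.add hlS hnS (by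
      intro u hu
      rw [hlt, Option.some.injEq] at hu
      subst hu
      refine ⟨h2.1 rfl, ?_⟩
      rw [h2.2 t rfl]
      exact SimpleGraph.Adj.symm hn) (fun u hu => absurd hu (ρ.par_ne_of_leaf hl hlt u))
    exact ⟨_, f', k1, ⟨subset_insert _ _, k2⟩, l, mem_insert _ _, k3⟩

/-! ### Colourings in which all degrees are infinite -/

/-- The neighbours of `a` adjacent to almost all non-neighbours of `a`. -/
def domNbrs (H : SimpleGraph ℕ) (W : Set ℕ) (a : ℕ) : Set ℕ :=
  {y | y ∈ W ∧ H.Adj a y ∧ {m | m ∈ W ∧ ¬ H.Adj a m ∧ ¬ H.Adj y m}.Finite}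

theorem infinite_inter_of_cofinite {A W : Set ℕ} (hA : A.Infinite) (hW : Wᶜ.Finite) :
    (A ∩ W).Infinite :=
  (hA.sdiff hW).mono fun _ hx => ⟨hx.1, not_not.1 hx.2⟩

theorem hasCofiniteCopy_of_branching_of_infinite_nbrs [Countable V] (hT : T.IsAcyclic) {s : V}
    (hL : ∀ n : ℕ, {x | T.Adj s x ∧ (n : ℕ∞) ≤ (leaves T x).encard}.Infinite)
    (hc : ∀ u v, u ≠ v → H.Adj u v ∨ G.Adj u v)
    (hW : Wᶜ.Finite) (hH : ∀ w ∈ W, (H.neighborSet w).Infinite)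
    (hG : ∀ w ∈ W, (G.neighborSet w).Infinite) :
    HasCofiniteCopy T H ∨ HasCofiniteCopy T G := by
  obtain ⟨ρ, hs⟩ := exists_rooting_at hT s
  obtain ⟨a, ha⟩ := hW.infinite_compl.nonempty
  rw [compl_compl] at ha
  set MH := {y | y ∈ W ∧ H.Adj a y} with hMH
  set MG := {y | y ∈ W ∧ ¬ H.Adj a y ∧ y ≠ a} with hMG
  have hMGa : ∀ y ∈ MG, G.Adj a y := fun y hy => (hc a y hy.2.2.symm).resolve_left hy.2.1
  set Y := domNbrs H W a with hY
  have hYinf : ∀ y ∈ MH \ Y, (G.neighborSet y ∩ MG).Infinite := by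
    rintro y ⟨hy, hyY⟩
    have h1 : {m | m ∈ W ∧ ¬ H.Adj a m ∧ ¬ H.Adj y m}.Infinite := fun h => hyY ⟨hy.1, hy.2, h⟩
    refine (h1.sdiff (finite_singleton a)).mono ?_
    rintro m ⟨⟨hm1, hm2, hm3⟩, hma⟩
    refine ⟨(hc y m ?_).resolve_left hm3, hm1, hm2, hma⟩
    rintro rfl
    exact hm2 hy.2
  have hcount : ∀ I : ℕ → Set ℕ, ∀ A : Set ℕ, (I '' A).Countable := fun I A =>
    (to_countable A).image I
  obtain ⟨K, hK⟩ := exists_splitting (𝒞 := ((fun w => H.neighborSet w ∩ W) '' W ∪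
      (fun w => G.neighborSet w ∩ W) '' W) ∪ ((fun y => G.neighborSet y ∩ MG) '' (MH \ Y) ∪
      {I | I = Y ∧ I.Infinite})) (((hcount _ _).union (hcount _ _)).union ((hcount _ _).union
        ((countable_singleton Y).mono fun I hI => hI.1))) (by
    rintro I ((⟨w, hw, rfl⟩ | ⟨w, hw, rfl⟩) | (⟨y, hy, rfl⟩ | hI))
    · exact infinite_inter_of_cofinite (hH w hw) hW
    · exact infinite_inter_of_cofinite (hG w hw) hW
    · exact hYinf y hy
    · exact hI.2)
  have hcov : ∀ n ∈ W, n ∉ MH → n ∉ MG → n = a := by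
    intro n hn h1 h2
    by_contra hna
    exact h2 ⟨hn, fun h => h1 ⟨hn, h⟩, hna⟩
  by_cases hYi : Y.Infinite
  · left
    have hYK := (hK Y (Or.inr (Or.inr ⟨rfl, hYi⟩))).1
    have hD : RobustDom H MG (Y ∩ K) := robustDom_of_infinite hYK fun p hp => by
      refine hp.1.2.2.subset ?_
      rintro z ⟨hz, hzp⟩
      exact ⟨hz.1, hz.2.1, fun h => hzp h.symm⟩
    obtain ⟨P', -, hsel⟩ := hD.exists_selectors
    obtain ⟨hPM, Z, hZM, hZfin, φ, hφ⟩ := hsel true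
    refine HasCofiniteCopy.of_subset ?_ (copy_of_branching ρ hs hL (W := W) (Gn := W ∩ Kᶜ)
      (M := MH) (Z := Z) (φ := φ) ha inter_subset_left ?_ (fun y hy => hy.1) (fun y hy => hy.2)
      ⟨fun z hz => ⟨?_, (hφ.1 z hz).2⟩, hφ.2⟩ ?_ (fun z hz h => h.2 (hPM (hφ.1 z hz).1).2))
    · refine ((hW.union hZfin).union (finite_singleton a)).subset fun n hn => ?_
      rw [mem_compl_iff, mem_union, not_or] at hn
      by_cases hnW : n ∈ W
      · by_cases hnG : n ∈ MG
        · exact Or.inl (Or.inr ⟨hnG, hn.2⟩)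
        · exact Or.inr (hcov n hnW hn.1 hnG)
      · exact Or.inl (Or.inl hnW)
    · intro w hw
      rw [← inter_assoc]
      exact (hK _ (Or.inl (Or.inl ⟨w, hw, rfl⟩))).2
    · have := (hPM (hφ.1 z hz).1).1
      exact ⟨this.1, this.2.1⟩
    · rw [disjoint_left]
      exact fun z hz hz' => (hZM hz).2.1 hz'.2
  · right
    rw [not_infinite] at hYi
    obtain ⟨φ, hφ⟩ := exists_selector_of_infinite (H := G) (Z := MH \ Y) (P := MG ∩ K) (by
      intro z hz
      rw [← inter_assoc]
      exact (hK _ (Or.inr (Or.inl ⟨z, hz, rfl⟩))).1)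
    refine HasCofiniteCopy.of_subset ?_ (copy_of_branching ρ hs hL (W := W) (Gn := W ∩ Kᶜ)
      (M := MG) (Z := MH \ Y) (φ := φ) ha inter_subset_left ?_ (fun y hy => hy.1) hMGa
      ⟨fun z hz => ⟨(hφ.1 z hz).1.1, (hφ.1 z hz).2⟩, hφ.2⟩ ?_
      (fun z hz h => h.2 (hφ.1 z hz).1.2))
    · refine ((hW.union hYi).union (finite_singleton a)).subset fun n hn => ?_
      rw [mem_compl_iff, mem_union, not_or] at hn
      by_cases hnW : n ∈ W
      · by_cases hnH : n ∈ MH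
        · by_cases hnY : n ∈ Y
          · exact Or.inl (Or.inr hnY)
          · exact absurd ⟨hnH, hnY⟩ hn.2
        · exact Or.inr (hcov n hnW hnH hn.1)
      · exact Or.inl (Or.inl hnW)
    · intro w hw
      rw [← inter_assoc]
      exact (hK _ (Or.inl (Or.inr ⟨w, hw, rfl⟩))).2
    · rw [disjoint_left]
      exact fun z hz hz' => hz'.2.1 hz.1.2

theorem hasCofiniteCopy_or_domNbrs_infinite [Countable V] (ρ : Rooting T) {t : V}
    (ht : ρ.par t = none)
    (h2 : {p | ρ.par p = some t ∧ ∃ q, ρ.par q = some p}.Infinite)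
    (hc : ∀ u v, u ≠ v → H.Adj u v ∨ G.Adj u v)
    (hW : Wᶜ.Finite) (hG : ∀ w ∈ W, (G.neighborSet w).Infinite) {a : ℕ} (ha : a ∈ W) :
    HasCofiniteCopy T G ∨ (domNbrs H W a).Infinite := by
  by_cases hY : (domNbrs H W a).Infinite
  · exact Or.inr hY
  left
  rw [not_infinite] at hY
  have hWinf : W.Infinite := by simpa using hW.infinite_compl
  refine HasCofiniteCopy.of_subset (A := W \ domNbrs H W a) ?_ (rooted_copy ρ (W := W) hWinf
    (fun w hw => infinite_inter_of_cofinite (hG w hw) hW) (RState.root ht ha) ?_)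
  · refine (hW.union hY).subset fun n hn => ?_
    by_contra hno
    rw [mem_union, not_or, mem_compl_iff, not_not] at hno
    exact hn hno
  · rintro S f h1 h3 n ⟨hnW, hnY⟩ hnS
    have htS : t ∈ S := h3.1 rfl
    have hft : f t = a := h3.2 t rfl
    have hna : a ≠ n := fun e => hnS ⟨t, htS, hft.trans e⟩
    by_cases hadj : H.Adj a n
    · have hinf : {m | m ∈ W ∧ ¬ H.Adj a m ∧ ¬ H.Adj n m}.Infinite := fun h => hnY ⟨hnW, hadj, h⟩
      obtain ⟨m, ⟨hm1, hm2, hm3⟩, hmS⟩ := hinf.exists_notMem_finite (h1.fin.image f)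
      have hma : a ≠ m := fun e => hmS ⟨t, htS, hft.trans e⟩
      have hmn : m ≠ n := fun e => hm2 (e ▸ hadj)
      exact h1.cover_grandchild htS h2 hm1 hmS hnW hnS
        (hft ▸ (hc a m hma).resolve_left hm2)
        ((hc m n hmn).resolve_left fun h => hm3 h.symm)
    · exact h1.cover_child htS (h2.mono fun p hp => hp.1) hnW hnS
        (hft ▸ (hc a n hna).resolve_left hadj)

theorem hasCofiniteCopy_of_three_legs [Countable V] (ρ : Rooting T) {t : V}
    (ht : ρ.par t = none)
    (h3 : {p | ρ.par p = some t ∧ ∃ q w, ρ.par q = some p ∧ ρ.par w = some q}.Infinite)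
    (hc : ∀ u v, u ≠ v → H.Adj u v ∨ G.Adj u v)
    (hW : Wᶜ.Finite) (hH : ∀ w ∈ W, (H.neighborSet w).Infinite)
    (hG : ∀ w ∈ W, (G.neighborSet w).Infinite) :
    HasCofiniteCopy T H ∨ HasCofiniteCopy T G := by
  have hWinf : W.Infinite := by simpa using hW.infinite_compl
  obtain ⟨a, ha⟩ := hWinf.nonempty
  have h2 : {p | ρ.par p = some t ∧ ∃ q, ρ.par q = some p}.Infinite :=
    h3.mono (by rintro p ⟨hp, q, _, hq, _⟩; exact ⟨hp, q, hq⟩)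
  rcases hasCofiniteCopy_or_domNbrs_infinite ρ ht h2 hc hW hG ha with h | hY
  · exact Or.inr h
  left
  refine HasCofiniteCopy.of_subset hW (rooted_copy ρ hWinf
    (fun w hw => infinite_inter_of_cofinite (hH w hw) hW) (RState.root ht ha) ?_)
  intro S f h1 hE n hnW hnS
  have htS : t ∈ S := hE.1 rfl
  have hft : f t = a := hE.2 t rfl
  have hfin := h1.fin.image f
  by_cases hadj : H.Adj a n
  · exact h1.cover_child htS (h2.mono fun p hp => hp.1) hnW hnS (hft ▸ hadj)
  by_cases hinf : ((H.neighborSet n ∩ W) ∩ H.neighborSet a).Infinite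
  · obtain ⟨m, ⟨⟨hm1, hm2⟩, hm3⟩, hmS⟩ := hinf.exists_notMem_finite hfin
    exact h1.cover_grandchild htS h2 hm2 hmS hnW hnS (hft ▸ hm3) (SimpleGraph.Adj.symm hm1)
  · rw [not_infinite] at hinf
    obtain ⟨l, hl, hlS⟩ := hY.exists_notMem_finite (hfin.insert n)
    rw [mem_insert_iff, not_or] at hlS
    obtain ⟨m, ⟨hm1, hm2⟩, hmS⟩ := (infinite_inter_of_cofinite (hH n hnW) hW).exists_notMem_finite
      ((hinf.union hl.2.2).union hfin)
    rw [mem_union, mem_union, not_or, not_or] at hmS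
    obtain ⟨⟨hma, hml⟩, hmS⟩ := hmS
    have hma' : ¬ H.Adj a m := fun h => hma ⟨⟨hm1, hm2⟩, h⟩
    have hlm : H.Adj l m := by
      by_contra h
      exact hml ⟨hm2, hma', h⟩
    exact h1.cover_greatgrandchild htS h3 hl.1 hlS.2 hm2 hmS hnW hnS (hft ▸ hl.2.1) hlm
      (SimpleGraph.Adj.symm hm1) hlS.1

/-! ### Two vertices of infinite degree -/

/-- There is a path with `k` edges inside `W` from `a` to a vertex of `Y`. -/
def PathTo (H : SimpleGraph ℕ) (W : Set ℕ) (a : ℕ) (Y : Set ℕ) (k : ℕ) : Prop :=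
  ∃ g : ℕ → ℕ, g 0 = a ∧ g k ∈ Y ∧ (∀ i ≤ k, g i ∈ W) ∧ (∀ i < k, H.Adj (g (i + 1)) (g i)) ∧
    ∀ j ≤ k, ∀ i < j, g i ≠ g j

theorem PathTo.snoc {a k : ℕ} {Y : Set ℕ} {g : ℕ → ℕ} (h0 : g 0 = a) (hW : ∀ i ≤ k, g i ∈ W)
    (hadj : ∀ i < k, H.Adj (g (i + 1)) (g i)) (hinj : ∀ j ≤ k, ∀ i < j, g i ≠ g j) {n : ℕ}
    (hn : n ∈ W) (hng : H.Adj n (g k)) (hni : ∀ i ≤ k, g i ≠ n) (hY : n ∈ Y) :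
    PathTo H W a Y (k + 1) := by
  refine ⟨fun i => if i ≤ k then g i else n, by simpa using h0, by simpa using hY, ?_, ?_, ?_⟩
  · intro i hi
    by_cases h : i ≤ k
    · simpa [h] using hW i h
    · simpa [h] using hn
  · intro i hi
    have hik : i ≤ k := by omega
    by_cases h : i + 1 ≤ k
    · simpa [h, hik] using hadj i h
    · obtain rfl : i = k := by omega
      simpa using hng
  · intro j hj i hi
    have hik : i ≤ k := by omega
    by_cases h : j ≤ k
    · simpa [h, hik] using hinj j h i hi
    · simpa [h, hik] using hni i hik

theorem PathTo.add_two {a k : ℕ} {Y M : Set ℕ} (hYinf : Y.Infinite) (hYW : Y ⊆ W) (hMinf : M.Infinite)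
    (hMW : M ⊆ W) (hYM : ∀ y ∈ Y, {m ∈ M | ¬ H.Adj y m}.Finite) (h : PathTo H W a Y k) :
    PathTo H W a Y (k + 2) := by
  obtain ⟨g, h0, hk, hW, hadj, hinj⟩ := h
  have hfin : (g '' Iic k).Finite := (finite_Iic k).image g
  obtain ⟨y, hy, hyg⟩ := hYinf.exists_notMem_finite hfin
  obtain ⟨m, hm, hmg⟩ := hMinf.exists_notMem_finite
    (((hYM _ hk).union (hYM y hy)).union (hfin.insert y))
  rw [mem_union, mem_union, not_or, not_or, mem_insert_iff, not_or] at hmg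
  obtain ⟨⟨hm1, hm2⟩, hmy, hmg⟩ := hmg
  have hadj1 : H.Adj (g k) m := by
    by_contra hno
    exact hm1 ⟨hm, hno⟩
  have hadj2 : H.Adj y m := by
    by_contra hno
    exact hm2 ⟨hm, hno⟩
  have hgm : ∀ i ≤ k, g i ≠ m := fun i hi e => hmg ⟨i, hi, e⟩
  refine PathTo.snoc (g := fun i => if i ≤ k then g i else m) (k := k + 1) (by simpa using h0)
    ?_ ?_ ?_ (hYW hy) (by simpa using hadj2) ?_ hy
  · intro i hi
    by_cases h : i ≤ k
    · simpa [h] using hW i h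
    · simpa [h] using hMW hm
  · intro i hi
    have hik : i ≤ k := by omega
    by_cases h : i + 1 ≤ k
    · simpa [h, hik] using hadj i h
    · obtain rfl : i = k := by omega
      simpa using hadj1.symm
  · intro j hj i hi
    have hik : i ≤ k := by omega
    by_cases h : j ≤ k
    · simpa [h, hik] using hinj j h i hi
    · simpa [h, hik] using hgm i hik
  · intro i hi
    by_cases h : i ≤ k
    · simpa [h] using fun e => hyg ⟨i, h, e⟩
    · simpa [h] using hmy

theorem hasCofiniteCopy_of_two_centres [Countable V] (ρ : Rooting T) {t x : V}
    (htinf : {v | ρ.par v = some t}.Infinite) (hxinf : {v | ρ.par v = some x}.Infinite)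
    (hW : Wᶜ.Finite) (hH : ∀ w ∈ W, (H.neighborSet w).Infinite) {a y : ℕ}
    (hy : y ∈ domNbrs H W a) {S₀ : Set V} {f₀ : V → ℕ} (h₀ : RState ρ H W S₀ f₀)
    (ht : t ∈ S₀) (hx : x ∈ S₀) (hta : f₀ t = a) (hxy : f₀ x = y) : HasCofiniteCopy T H := by
  have hWinf : W.Infinite := by simpa using hW.infinite_compl
  refine HasCofiniteCopy.of_subset (A := W \ {m | m ∈ W ∧ ¬ H.Adj a m ∧ ¬ H.Adj y m}) ?_
    (rooted_copy ρ hWinf (fun w hw => infinite_inter_of_cofinite (hH w hw) hW) h₀ ?_)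
  · refine (hW.union hy.2.2).subset fun n hn => ?_
    by_contra hno
    rw [mem_union, not_or, mem_compl_iff, not_not] at hno
    exact hn hno
  · rintro S f h1 hE n ⟨hnW, hn⟩ hnS
    by_cases hadj : H.Adj a n
    · exact h1.cover_child (hE.1 ht) htinf hnW hnS (by rwa [hE.2 t ht, hta])
    · refine h1.cover_child (hE.1 hx) hxinf hnW hnS ?_
      rw [hE.2 x hx, hxy]
      by_contra hno
      exact hn ⟨hnW, hadj, hno⟩

theorem hasCofiniteCopy_of_pathTo [Countable V] (ρ : Rooting T) {k : ℕ} {c : ℕ → V}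
    (hc0 : ρ.par (c 0) = none) (hck : ∀ i < k, ρ.par (c (i + 1)) = some (c i))
    (htinf : {v | ρ.par v = some (c 0)}.Infinite) (hxinf : {v | ρ.par v = some (c k)}.Infinite)
    (hW : Wᶜ.Finite) (hH : ∀ w ∈ W, (H.neighborSet w).Infinite) {a : ℕ} {Y : Set ℕ}
    (hYa : Y ⊆ domNbrs H W a) (hp : PathTo H W a Y k) : HasCofiniteCopy T H := by
  obtain ⟨g, h0, hk, hgW, hadj, hinj⟩ := hp
  have hnot : ∀ i < k, c (i + 1) ∉ ({c 0} : Set V) := fun i hi h =>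
    ρ.injOn_chain hck (Nat.succ_pos i) hi h.symm
  obtain ⟨S', f', k1, k2, k3, -⟩ := (RState.root (H := H) hc0 (hgW 0 (Nat.zero_le k))).add_chain
    (c := c) (g := g) rfl rfl k hck hnot (fun i hi => hgW _ hi) (by
      rintro i hi ⟨v, -, hv⟩
      exact hinj (i + 1) hi 0 (Nat.succ_pos i) hv) hadj hinj
  exact hasCofiniteCopy_of_two_centres ρ htinf hxinf hW hH (hYa hk) k1 (k3 0 (Nat.zero_le k)).1
    (k3 k le_rfl).1 ((k3 0 (Nat.zero_le k)).2.trans h0) (k3 k le_rfl).2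

theorem hasCofiniteCopy_of_two_infinite_degrees [Countable V] (hT : T.IsAcyclic) {t x : V}
    (htx : t ≠ x) (ht2 : {p | T.Adj t p ∧ ¬ IsLeaf T p}.Infinite)
    (hxinf : (T.neighborSet x).Infinite)
    (hc : ∀ u v, u ≠ v → H.Adj u v ∨ G.Adj u v) (hd : ∀ u v, H.Adj u v → ¬ G.Adj u v)
    (hW : Wᶜ.Finite) (hH : ∀ w ∈ W, (H.neighborSet w).Infinite)
    (hG : ∀ w ∈ W, (G.neighborSet w).Infinite) :
    HasCofiniteCopy T H ∨ HasCofiniteCopy T G := by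
  obtain ⟨ρ, ht, hx, htu⟩ := exists_rooting_pair hT t x
  have hWinf : W.Infinite := by simpa using hW.infinite_compl
  obtain ⟨a, ha⟩ := hWinf.nonempty
  have h2 : {p | ρ.par p = some t ∧ ∃ q, ρ.par q = some p}.Infinite :=
    ht2.mono fun p hp => ⟨ρ.par_of_adj ht hp.1, ρ.exists_child (ρ.par_of_adj ht hp.1) hp.2⟩
  have h1 : {v | ρ.par v = some t}.Infinite := h2.mono fun p hp => hp.1
  have hxinf' : {v | ρ.par v = some x}.Infinite := by
    have hfin : {v | ρ.par x = some v}.Finite :=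
      Set.Subsingleton.finite fun u hu v hv => Option.some.inj (hu.symm.trans hv)
    refine (hxinf.sdiff hfin).mono ?_
    rintro v ⟨hv, hv'⟩
    exact ((ρ.adj_iff x v).1 hv).resolve_left hv'
  rcases hasCofiniteCopy_or_domNbrs_infinite ρ ht h2 hc hW hG ha with h | hY
  · exact Or.inr h
  by_cases hr : T.Reachable t x
  · obtain ⟨k, c, hk, hc0, hck⟩ := ρ.exists_chain x
    have hc0t : c 0 = t :=
      htu _ (hr.trans (hk ▸ (ρ.reachable_chain hck k le_rfl).symm)) hc0
    have hk0 : k ≠ 0 := by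
      rintro rfl
      exact htx (hc0t ▸ hk)
    rw [← hc0t] at h1
    rw [← hk] at hxinf'
    have hYW : domNbrs H W a ⊆ W := fun y hy => hy.1
    have hMinf : {m | m ∈ W ∧ ¬ H.Adj a m}.Infinite :=
      (infinite_inter_of_cofinite (hG a ha) hW).mono fun m hm => ⟨hm.2, fun h => hd _ _ h hm.1⟩
    have step : ∀ k, PathTo H W a (domNbrs H W a) k → PathTo H W a (domNbrs H W a) (k + 2) :=
      fun k => PathTo.add_two hY hYW hMinf (fun m hm => hm.1) fun y hy =>
        hy.2.2.subset fun m hm => ⟨hm.1.1, hm.1.2, hm.2⟩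
    rcases Nat.even_or_odd' k with ⟨j, rfl | rfl⟩
    · obtain ⟨j, rfl⟩ : ∃ i, j = i + 1 := ⟨j - 1, by omega⟩
      by_cases hp : ∃ y ∈ domNbrs H W a, ∃ p ∈ W, H.Adj a p ∧ H.Adj y p
      · left
        obtain ⟨y, hy, p, hpW, hap, hyp⟩ := hp
        have hp2 : PathTo H W a (domNbrs H W a) 2 :=
          PathTo.snoc (g := fun i => if i = 0 then a else p) (k := 1) (by simp) (by
            intro i hi
            interval_cases i
            · simpa using ha
            · simpa using hpW) (by
            intro i hi
            interval_cases i
            simpa using hap.symm) (by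
            intro j hj i hi
            interval_cases j <;> interval_cases i
            simpa using hap.ne) hy.1 (by simpa using hyp) (by
            intro i hi
            interval_cases i
            · simpa using hy.2.1.ne
            · simpa using hyp.ne') hy
        have hall : ∀ j, PathTo H W a (domNbrs H W a) (2 * (j + 1)) := by
          intro j
          induction j with
          | zero => exact hp2
          | succ j ih => exact step _ ih
        exact hasCofiniteCopy_of_pathTo ρ hc0 hck h1 hxinf' hW hH Subset.rfl (hall j)
      · push Not at hp
        obtain ⟨b, hb⟩ := hY.nonempty
        have hbW : b ∈ W := hb.1
        rcases hasCofiniteCopy_or_domNbrs_infinite ρ ht h2 (fun u v h => (hc u v h).symm) hW hH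
          hbW with h | hY'
        · exact Or.inl h
        right
        set Y' := {y | y ∈ domNbrs G W b ∧ H.Adj a y} with hY'def
        have hY'inf : Y'.Infinite := by
          refine (hY'.sdiff hb.2.2).mono ?_
          rintro y ⟨hy, hy'⟩
          refine ⟨hy, ?_⟩
          by_contra hay
          exact hy' ⟨hy.1, hay, fun h => hd _ _ h hy.2.1⟩
        have hGadj : ∀ y ∈ domNbrs H W a, ∀ p ∈ W, H.Adj a p → y ≠ p → G.Adj y p :=
          fun y hy p hpW hap hne => (hc y p hne).resolve_left (hp y hy p hpW hap)
        obtain ⟨y', hy'⟩ := hY'inf.nonempty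
        have hby' : b ≠ y' := hy'.1.2.1.ne
        obtain ⟨y₁, hy₁, hne⟩ := hY.exists_notMem_finite (toFinite {b, y'})
        simp only [mem_insert_iff, mem_singleton_iff, not_or] at hne
        have hby₁ : G.Adj b y₁ := hGadj b hb y₁ hy₁.1 hy₁.2.1 (Ne.symm hne.1)
        have hy₁y' : G.Adj y₁ y' := hGadj y₁ hy₁ y' hy'.1.1 hy'.2 hne.2
        have hp2 : PathTo G W b Y' 2 :=
          PathTo.snoc (g := fun i => if i = 0 then b else y₁) (k := 1) (by simp) (by
            intro i hi
            interval_cases i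
            · simpa using hbW
            · simpa using hy₁.1) (by
            intro i hi
            interval_cases i
            simpa using hby₁.symm) (by
            intro j hj i hi
            interval_cases j <;> interval_cases i
            simpa using hby₁.ne) hy'.1.1 (by simpa using hy₁y'.symm) (by
            intro i hi
            interval_cases i
            · simpa using hby'
            · simpa using hne.2) hy'
        have hall : ∀ j, PathTo G W b Y' (2 * (j + 1)) := by
          intro j
          induction j with
          | zero => exact hp2
          | succ j ih =>
            refine PathTo.add_two (M := {m | m ∈ W ∧ ¬ G.Adj b m}) hY'inf (fun y hy => hy.1.1)
              ((infinite_inter_of_cofinite (hH b hbW) hW).mono fun m hm =>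
                ⟨hm.2, fun h => hd _ _ hm.1 h⟩) (fun m hm => hm.1) (fun y hy => ?_) ih
            exact hy.1.2.2.subset fun m hm => ⟨hm.1.1, hm.1.2, hm.2⟩
        exact hasCofiniteCopy_of_pathTo ρ hc0 hck h1 hxinf' hW hG (fun y hy => hy.1) (hall j)
    · left
      have hall : ∀ j, PathTo H W a (domNbrs H W a) (2 * j + 1) := by
        intro j
        induction j with
        | zero =>
          obtain ⟨y, hy⟩ := hY.nonempty
          exact PathTo.snoc (g := fun _ => a) (k := 0) rfl (fun _ _ => ha) (by simp) (by
            intro j hj i hi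
            omega) hy.1 hy.2.1.symm (fun _ _ => hy.2.1.ne) hy
        | succ j ih => exact step _ ih
      exact hasCofiniteCopy_of_pathTo ρ hc0 hck h1 hxinf' hW hH Subset.rfl (hall j)
  · left
    obtain ⟨y, hy⟩ := hY.nonempty
    obtain ⟨f', k1, k2, k3⟩ := (RState.root (H := H) ht ha).add (v := x) (n := y)
      (fun h => htx h.symm) (by simpa using hy.2.1.ne') (by simp [hx hr]) (fun _ _ => hy.1)
    exact hasCofiniteCopy_of_two_centres ρ h1 hxinf' hW hH hy k1 (mem_insert_of_mem _ rfl)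
      (mem_insert _ _) (k2 t rfl) k3

end Rooted

/-! ### Iterated neighbourhoods -/

section Structure

variable {T : SimpleGraph V}

theorem mem_nbhd {S : Set V} {v : V} : v ∈ nbhd T S ↔ ∃ u ∈ S, T.Adj u v := by
  simp [nbhd]

/-- The set of vertices at distance at most one from `S`. -/
def closedNbhd (T : SimpleGraph V) (S : Set V) : Set V :=
  S ∪ nbhd T S

theorem closedNbhd_iterate_mono (S : Set V) : Monotone fun i => (closedNbhd T)^[i] S :=
  monotone_nat_of_le_succ fun i => by
    rw [Function.iterate_succ_apply']
    exact subset_union_left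

theorem mem_closedNbhd_iterate_succ {S : Set V} {i : ℕ} {u v : V}
    (hu : u ∈ (closedNbhd T)^[i] S) (huv : T.Adj u v) : v ∈ (closedNbhd T)^[i + 1] S := by
  rw [Function.iterate_succ_apply']
  exact Or.inr (mem_nbhd.2 ⟨u, hu, huv⟩)

theorem Rooting.mem_closedNbhd_iterate (ρ : Rooting T) {S : Set V} {k i : ℕ} {c : ℕ → V}
    (hck : ∀ i < k, ρ.par (c (i + 1)) = some (c i)) (hi : c i ∈ S) :
    ∀ j, i + j ≤ k → c (i + j) ∈ (closedNbhd T)^[j] S := by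
  intro j
  induction j with
  | zero => exact fun _ => hi
  | succ j ih =>
    intro hj
    exact mem_closedNbhd_iterate_succ (ih (by omega)) (ρ.adj_of_par (hck (i + j) (by omega)))

/-- If finitely many vertices have bounded distance to all others and the forest has no finite
dominating set, then some vertex has infinitely many neighbours which are not leaves. -/
theorem exists_infinite_nonleaf_nbrs (hD : ¬ HasFiniteDominatingSet T) {n : ℕ} {S : Set V}
    (hS : S.Finite) (h : ∀ w, w ∈ (closedNbhd T)^[n] S) :
    ∃ t, {p | T.Adj t p ∧ ¬ IsLeaf T p}.Infinite := by
  by_contra hno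
  push Not at hno
  have key : ∀ i, ∃ X : Set V, X.Finite ∧ ∀ v ∈ (closedNbhd T)^[i] S, v ∈ X ∨
      ∃ u ∈ X, v ∈ leaves T u := by
    intro i
    induction i with
    | zero => exact ⟨S, hS, fun v hv => Or.inl hv⟩
    | succ i ih =>
      obtain ⟨X, hX, h⟩ := ih
      refine ⟨X ∪ ⋃ t ∈ X, {p | T.Adj t p ∧ ¬ IsLeaf T p},
        hX.union (hX.biUnion fun t _ => hno t), fun v hv => ?_⟩
      rw [Function.iterate_succ_apply'] at hv
      rcases hv with hv | hv
      · rcases h v hv with hv | ⟨u, hu, hv⟩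
        · exact Or.inl (Or.inl hv)
        · exact Or.inr ⟨u, Or.inl hu, hv⟩
      · obtain ⟨u, hu, huv⟩ := mem_nbhd.1 hv
        rcases h u hu with hu | ⟨s, hs, hu⟩
        · by_cases hl : IsLeaf T v
          · exact Or.inr ⟨u, Or.inl hu, huv, hl⟩
          · exact Or.inl (Or.inr (mem_biUnion hu ⟨huv, hl⟩))
        · rw [eq_of_mem_leaves hu huv]
          exact Or.inl (Or.inl hs)
  obtain ⟨X, hX, hXD⟩ := key n
  refine hD ⟨X, hX, fun v hv => ?_⟩
  obtain ⟨u, hu, hv'⟩ := (hXD v (h v)).resolve_left hv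
  exact ⟨u, hu, hv'.1.symm⟩

theorem encard_biUnion_le {ι : Type*} (N : Finset ι) (D : ι → Set V) {n : ℕ∞}
    (h : ∀ x ∈ N, (D x).encard ≤ n) : (⋃ x ∈ N, D x).encard ≤ N.card * n := by
  classical
  induction N using Finset.induction_on with
  | empty => simp
  | insert a N ha ih =>
    rw [Finset.set_biUnion_insert, Finset.card_insert_of_notMem ha]
    refine (encard_union_le _ _).trans ?_
    push_cast
    rw [add_mul, one_mul, add_comm]
    exact add_le_add (ih fun x hx => h x (Finset.mem_insert_of_mem hx))
      (h a (Finset.mem_insert_self _ _))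

/-- A strongly contracting forest with few isolated vertices has large stars of leaves. -/
theorem StronglyContracting.exists_leaves (h : StronglyContracting T) (hT : T.IsAcyclic)
    (hI : {v | T.neighborSet v = ∅}.Finite) (n : ℕ) : ∃ x, (n : ℕ∞) ≤ (leaves T x).encard := by
  by_contra hno
  push Not at hno
  obtain ⟨ρ⟩ := nonempty_rooting hT
  obtain ⟨k, hk⟩ := h
  obtain ⟨A, -, hA1, hA2⟩ := hk ({v | T.neighborSet v = ∅}.ncard + k * (n + 1) + 1)
  have hfin : (nbhd T A).Finite := finite_of_encard_le_coe hA2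
  let D : V → Set V := fun x => leaves T x ∪ {v | ρ.par x = some v}
  have hD : ∀ x, (D x).encard ≤ (n + 1 : ℕ) := by
    intro x
    refine (encard_union_le _ _).trans ?_
    push_cast
    refine add_le_add (hno x).le (encard_le_one_iff.2 fun a b ha hb => ?_)
    exact Option.some.inj ((show ρ.par x = some a from ha).symm.trans hb)
  have hsub : A ⊆ {v | T.neighborSet v = ∅} ∪ ⋃ x ∈ hfin.toFinset, D x := by
    intro a ha
    by_cases hiso : T.neighborSet a = ∅
    · exact Or.inl hiso
    right
    obtain ⟨u, hu⟩ := nonempty_iff_ne_empty.2 hiso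
    have hu' : T.Adj a u := hu
    have hmem : ∀ x, T.Adj a x → x ∈ hfin.toFinset := fun x hx => by
      rw [Finite.mem_toFinset]
      exact mem_nbhd.2 ⟨a, ha, hx⟩
    by_cases hl : IsLeaf T a
    · exact mem_biUnion (hmem u hu') (Or.inl ⟨hu'.symm, hl⟩)
    obtain ⟨x, hx⟩ : ∃ x, ρ.par x = some a := by
      rcases (ρ.adj_iff a u).1 hu' with h' | h'
      · exact ρ.exists_child h' hl
      · exact ⟨u, h'⟩
    exact mem_biUnion (hmem x (ρ.adj_of_par hx)) (Or.inr hx)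
  have hcard : (hfin.toFinset.card : ℕ∞) ≤ k := by
    rwa [← hfin.encard_eq_coe_toFinset_card]
  have h1 := hA1.trans ((encard_le_encard hsub).trans ((encard_union_le _ _).trans
    (add_le_add le_rfl (encard_biUnion_le _ D fun x _ => hD x))))
  rw [← hI.cast_ncard_eq] at h1
  have h2 : hfin.toFinset.card ≤ k := by exact_mod_cast hcard
  have h3 : {v | T.neighborSet v = ∅}.ncard + k * (n + 1) + 1 ≤
      {v | T.neighborSet v = ∅}.ncard + hfin.toFinset.card * (n + 1) := by exact_mod_cast h1
  have h4 := Nat.mul_le_mul_right (n + 1) h2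
  omega

theorem edist_le_two {t u v : V} (h : T.Adj t u) (h' : T.Adj u v) : T.edist t v ≤ 2 :=
  SimpleGraph.Walk.edist_le (.cons h (.cons h' .nil))

/-- The forests with one vertex of infinite degree that admit none of the embeddings are in the
exceptional family. -/
theorem inTStar_of_finite_three_legs (hT : T.IsAcyclic) (ρ : Rooting T) {t : V}
    (ht : ρ.par t = none) (hleaf : (leaves T t).Infinite)
    (hnl : {p | T.Adj t p ∧ ¬ IsLeaf T p}.Infinite)
    (hdeg : ∀ v, v ≠ t → (T.neighborSet v).Finite)
    (h3 : {p | ρ.par p = some t ∧ ∃ q w, ρ.par q = some p ∧ ρ.par w = some q}.Finite)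
    {S : Set V} (hS : S.Finite) {n : ℕ} (hcov : ∀ w, w ∈ (closedNbhd T)^[n] S)
    {S₁ : Set V} (hS₁ : S₁.Finite) {n₁ : ℕ} (hb : ∀ x ∉ S₁, (leaves T x).encard ≤ n₁) :
    InTStar T := by
  set Q := {p | ρ.par p = some t ∧ ∃ q w, ρ.par q = some p ∧ ρ.par w = some q} with hQ
  have hpt : ∀ {u p}, ρ.par u = some p → u ≠ t := by
    rintro u p h rfl
    rw [ht] at h
    cases h
  let C : Set V := ⋃ p ∈ Q, T.neighborSet p
  have hC : C.Finite := h3.biUnion fun p hp => hdeg p (hpt hp.1)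
  let D : Set V := ⋃ u ∈ C \ {t}, T.neighborSet u
  have hD : D.Finite := (hC.subset sdiff_subset).biUnion fun u hu => hdeg u hu.2
  have key : ∀ i, ∃ K : Set V, K.Finite ∧ ∀ v ∈ (closedNbhd T)^[i] S,
      v = t ∨ ρ.par v = some t ∨ (∃ p, ρ.par v = some p ∧ ρ.par p = some t) ∨ v ∈ K := by
    intro i
    induction i with
    | zero => exact ⟨S, hS, fun v hv => Or.inr (Or.inr (Or.inr hv))⟩
    | succ i ih =>
      obtain ⟨K, hK, h⟩ := ih
      refine ⟨K ∪ D ∪ ⋃ u ∈ K \ {t}, T.neighborSet u, (hK.union hD).union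
        ((hK.subset sdiff_subset).biUnion fun u hu => hdeg u hu.2), fun v hv => ?_⟩
      rw [Function.iterate_succ_apply'] at hv
      rcases hv with hv | hv
      · rcases h v hv with hv | hv | hv | hv
        · exact Or.inl hv
        · exact Or.inr (Or.inl hv)
        · exact Or.inr (Or.inr (Or.inl hv))
        · exact Or.inr (Or.inr (Or.inr (Or.inl (Or.inl hv))))
      · obtain ⟨u, hu, huv⟩ := mem_nbhd.1 hv
        by_cases hut : u = t
        · subst hut
          exact Or.inr (Or.inl (ρ.par_of_adj ht huv))
        rcases (h u hu).resolve_left hut with hu | ⟨p, hup, hp⟩ | hu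
        · rcases (ρ.adj_iff u v).1 huv with h' | h'
          · rw [hu, Option.some.injEq] at h'
            exact Or.inl h'.symm
          · exact Or.inr (Or.inr (Or.inl ⟨u, h', hu⟩))
        · rcases (ρ.adj_iff u v).1 huv with h' | h'
          · rw [hup, Option.some.injEq] at h'
            subst h'
            exact Or.inr (Or.inl hp)
          · refine Or.inr (Or.inr (Or.inr (Or.inl (Or.inr ?_))))
            have huC : u ∈ C := mem_biUnion (show p ∈ Q from ⟨hp, u, v, hup, h'⟩)
              (ρ.adj_of_par hup)
            exact mem_biUnion (show u ∈ C \ {t} from ⟨huC, hut⟩) huv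
        · exact Or.inr (Or.inr (Or.inr (Or.inr
            (mem_biUnion (show u ∈ K \ {t} from ⟨hu, hut⟩) huv))))
  obtain ⟨K, hK, hKcov⟩ := key n
  have hclass := fun v => hKcov v (hcov v)
  obtain ⟨m, hm⟩ := ((((hK.union hS₁).union (h3.union hC))).image
    fun v => (T.neighborSet v).ncard).bddAbove
  refine ⟨hT, t, max m (n₁ + 1), hleaf.mono fun v hv => hv.1, fun v hvt => ?_, hleaf, hnl,
    hK.subset fun v hv => ?_⟩
  · by_cases hex : v ∈ K ∪ S₁ ∪ (Q ∪ C)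
    · rw [← (hdeg v hvt).cast_ncard_eq]
      exact_mod_cast (hm ⟨v, hex, rfl⟩).trans (le_max_left _ _)
    simp only [mem_union, not_or] at hex
    obtain ⟨⟨hvK, hvS⟩, hvQ, hvC⟩ := hex
    obtain ⟨p, hp, hsub⟩ : ∃ p, ρ.par v = some p ∧ ∀ u, ρ.par u = some v → u ∈ leaves T v := by
      rcases (hclass v).resolve_left hvt with h | ⟨p, hvp, hp⟩ | h
      · refine ⟨t, h, fun u hu => ⟨ρ.adj_of_par hu, ?_⟩⟩
        by_contra hl
        obtain ⟨w, hw⟩ := ρ.exists_child hu hl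
        exact hvQ ⟨h, u, w, hu, hw⟩
      · refine ⟨p, hvp, fun u hu => ?_⟩
        exact absurd (mem_biUnion (show p ∈ Q from ⟨hp, v, u, hvp, hu⟩) (ρ.adj_of_par hvp)) hvC
      · exact absurd h hvK
    have hle : T.neighborSet v ⊆ leaves T v ∪ {p} := by
      intro u hu
      rcases (ρ.adj_iff v u).1 hu with h' | h'
      · rw [hp, Option.some.injEq] at h'
        exact Or.inr h'.symm
      · exact Or.inl (hsub u h')
    refine (encard_le_encard hle).trans ((encard_union_le _ _).trans ?_)
    rw [encard_singleton]
    refine (add_le_add (hb v hvS) le_rfl).trans ?_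
    exact_mod_cast le_max_right m (n₁ + 1)
  · rcases hclass v with rfl | h | ⟨p, hvp, hp⟩ | h
    · exact absurd (by simp) hv
    · refine absurd ?_ hv
      exact (SimpleGraph.Walk.edist_le (.cons (ρ.adj_of_par h) .nil)).trans (by
        norm_num [SimpleGraph.Walk.length])
    · exact absurd (edist_le_two (ρ.adj_of_par hp) (ρ.adj_of_par hvp)) hv
    · exact h

end Structure

/-! ### Forests with vertices far from every finite set -/

section Far

variable {T : SimpleGraph V} {H G : SimpleGraph ℕ} {W : Set ℕ}

theorem exists_path_to {B R Φ : Set ℕ} (hW : W ⊆ B ∪ R)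
    (hH : ∀ w ∈ W, (H.neighborSet w ∩ W).Infinite) (hRW : R ⊆ W)
    (hRR : ∀ u ∈ R, (H.neighborSet u ∩ R).Infinite) (hD : RobustDom H B R) {v : ℕ} (hv : v ∈ W)
    (hΦ : Φ.Finite) :
    ∃ u r, u ∈ W ∧ r ∈ R ∧ u ∉ Φ ∧ r ∉ Φ ∧ H.Adj v u ∧ H.Adj u r := by
  by_cases hinf : (H.neighborSet v ∩ R).Infinite
  · obtain ⟨u, ⟨hvu, hu⟩, huΦ⟩ := hinf.exists_notMem_finite hΦ
    obtain ⟨r, ⟨hur, hr⟩, hrΦ⟩ := (hRR u hu).exists_notMem_finite hΦ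
    exact ⟨u, r, hRW hu, hr, huΦ, hrΦ, hvu, hur⟩
  rw [not_infinite] at hinf
  obtain ⟨F, -, hF, hdom⟩ := hD Φ hΦ
  obtain ⟨u, ⟨hvu, hu⟩, huΦ⟩ := (hH v hv).exists_notMem_finite ((hinf.union hdom).union hΦ)
  simp only [mem_union, not_or] at huΦ
  obtain ⟨⟨hu1, hu2⟩, huΦ⟩ := huΦ
  have huB : u ∈ B := (hW hu).resolve_right fun h => hu1 ⟨hvu, h⟩
  obtain ⟨r, hr, hur⟩ : ∃ p ∈ F, H.Adj u p := by
    by_contra hno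
    push Not at hno
    exact hu2 ⟨huB, hno⟩
  exact ⟨u, r, hu, (hF hr).1, huΦ, (hF hr).2, hvu, hur⟩

theorem hasCofiniteCopy_of_far_vertices [Countable V] (hT : T.IsAcyclic)
    (hI : {v | T.neighborSet v = ∅}.Finite)
    (hfar : ∀ S : Set V, S.Finite → ∃ w, w ∉ (closedNbhd T)^[5] S)
    (hc : ∀ u v, u ≠ v → H.Adj u v ∨ G.Adj u v)
    {U : Ultrafilter ℕ} (hU : ∀ s ∈ U, s.Infinite) (hR : {v | H.neighborSet v ∈ U} ∈ U)
    (hW : Wᶜ.Finite) (hH : ∀ w ∈ W, (H.neighborSet w).Infinite) :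
    HasCofiniteCopy T H ∨ HasCofiniteCopy T G := by
  have hWU : W ∈ U := by
    by_contra h
    exact hU _ (Ultrafilter.compl_mem_iff_notMem.2 h) hW
  set R := {v | H.neighborSet v ∈ U} ∩ W with hRdef
  have hRU : R ∈ U := inter_mem hR hWU
  by_cases hD : RobustDom H (W \ R) R
  · left
    have hHW : ∀ w ∈ W, (H.neighborSet w ∩ W).Infinite := fun w hw =>
      infinite_inter_of_cofinite (hH w hw) hW
    have hWinf : W.Infinite := hU W hWU
    obtain ⟨ρ⟩ := nonempty_rooting hT
    refine HasCofiniteCopy.of_subset hW (rooted_copy ρ hWinf hHW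
      (RState.empty (ρ := ρ) (fun _ => 0)) ?_)
    intro S f h1 _ n hn hnS
    obtain ⟨w, hw⟩ := hfar S h1.fin
    obtain ⟨k, c, hck, hc0, hcp⟩ := ρ.exists_chain w
    by_cases hcS : c 0 ∈ S
    · classical
      set i := Nat.findGreatest (fun i => c i ∈ S) k with hi
      have hiS : c i ∈ S := Nat.findGreatest_spec (P := fun i => c i ∈ S) (Nat.zero_le k) hcS
      have hgt : ∀ j, i < j → j ≤ k → c j ∉ S := fun j h h' =>
        Nat.findGreatest_is_greatest h h'
      have hik : i ≤ k := Nat.findGreatest_le k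
      have hk6 : i + 6 ≤ k := by
        by_contra hlt
        have h2 := ρ.mem_closedNbhd_iterate hcp hiS (k - i) (by omega)
        rw [show i + (k - i) = k by omega, hck] at h2
        exact hw (closedNbhd_iterate_mono S (show k - i ≤ 5 by omega) h2)
      have hlink := fun {Φ : Set ℕ} (v : ℕ) (hv : v ∈ W) (hΦ : Φ.Finite) =>
        exists_path_to (B := W \ R) (R := R) (Φ := Φ) (by simp) hHW inter_subset_right
          (fun u hu => hU _ (inter_mem hu.1 hRU)) hD hv hΦ
      have hfi : f (c i) ∈ W := h1.inW _ _ hiS (hcp i (by omega))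
      have hfin : (insert n (f '' S)).Finite := (h1.fin.image f).insert n
      obtain ⟨u, r, hu, hr, huΦ, hrΦ, hvu, hur⟩ := hlink (f (c i)) hfi hfin
      obtain ⟨u', r', hu', hr', huΦ', hrΦ', hnu, hur'⟩ := hlink n hn ((hfin.insert u).insert r)
      obtain ⟨m, ⟨hm1, hmW⟩, hmΦ⟩ := (hU _ (inter_mem (common_mem (H := H) (F := {r, r'})
        (toFinite _) (by
          rintro p (rfl | rfl)
          · exact hr.1
          · exact hr'.1)) hWU)).exists_notMem_finite
            ((((hfin.insert u).insert r).insert u').insert r')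
      have hmr : H.Adj m r := hm1 r (by simp)
      have hmr' : H.Adj m r' := hm1 r' (by simp)
      have hfS : f (c i) ∈ f '' S := ⟨_, hiS, rfl⟩
      simp only [mem_insert_iff, not_or] at huΦ hrΦ huΦ' hrΦ' hmΦ
      have e1 := hur.ne
      have e2 := hur'.ne
      have hne : ∀ x, x ∉ f '' S → f (c i) ≠ x := fun x hx e => hx (e ▸ hfS)
      let g : ℕ → ℕ := fun j => if j = 0 then f (c i) else if j = 1 then u else
        if j = 2 then r else if j = 3 then m else if j = 4 then r' else if j = 5 then u' else n
      obtain ⟨S', f', k1, k2, k3, -⟩ := h1.add_chain (c := fun j => c (i + j)) (g := g) hiS rfl 6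
        (fun j hj => hcp (i + j) (by omega)) (fun j hj => hgt _ (by omega) (by omega))
        (by
          intro j hj
          interval_cases j
          exacts [hu, hr.2, hmW, hr'.2, hu', hn])
        (by
          intro j hj
          interval_cases j
          exacts [huΦ.2, hrΦ.2, hmΦ.2.2.2.2.2, hrΦ'.2.2.2, huΦ'.2.2.2, hnS])
        (by
          intro j hj
          interval_cases j
          exacts [hvu.symm, hur.symm, hmr, hmr'.symm, hur', hnu])
        (by
          intro j hj l hl
          have hu0 := hne u huΦ.2
          have hr0 := hne r hrΦ.2
          have hm0 := hne m hmΦ.2.2.2.2.2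
          have hr0' := hne r' hrΦ'.2.2.2
          have hu0' := hne u' huΦ'.2.2.2
          have hn0 := hne n hnS
          interval_cases j <;> interval_cases l <;> simp only [g] <;> grind)
      exact ⟨S', f', k1, k2, c (i + 6), (k3 6 le_rfl).1, (k3 6 le_rfl).2⟩
    · obtain ⟨f', k1, k2, k3⟩ := h1.add hcS hnS (by simp [hc0]) (fun _ _ => hn)
      exact ⟨_, f', k1, ⟨subset_insert _ _, k2⟩, c 0, mem_insert _ _, k3⟩
  · right
    obtain ⟨col, hcol⟩ := exists_bool_coloring hT
    refine hasCofiniteCopy_of_not_robustDom hc hU hRU ?_ ?_ col hcol ?_ hD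
    · intro b hb
      exact (neighborSet_mem_or hU hc b).resolve_left fun h => hb.2 ⟨h, hb.1⟩
    · rwa [sdiff_union_of_subset inter_subset_right]
    · intro S hS ε
      obtain ⟨w, hw⟩ := hfar (S ∪ {v | T.neighborSet v = ∅}) (hS.union hI)
      have hw' : ∀ i ≤ 5, w ∉ (closedNbhd T)^[i] (S ∪ {v | T.neighborSet v = ∅}) :=
        fun i hi h => hw (closedNbhd_iterate_mono _ hi h)
      have hgood : ∀ x, x ∉ (closedNbhd T)^[1] (S ∪ {v | T.neighborSet v = ∅}) →
          x ∉ S ∧ ∀ s ∈ S, ¬ T.Adj x s := fun x hx =>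
        ⟨fun h => hx (Or.inl (Or.inl h)), fun s hs h => hx
          (mem_closedNbhd_iterate_succ (i := 0) (show s ∈ S ∪ _ from Or.inl hs) h.symm)⟩
      obtain ⟨w', hww'⟩ := nonempty_iff_ne_empty.2 fun h : T.neighborSet w = ∅ =>
        hw' 0 (by omega) (Or.inr h)
      have hw1 : w' ∉ (closedNbhd T)^[1] (S ∪ {v | T.neighborSet v = ∅}) := fun h =>
        hw' 2 (by omega) (mem_closedNbhd_iterate_succ h (SimpleGraph.Adj.symm hww'))
      by_cases hε : col w = ε
      · exact ⟨w, hε, hgood w (hw' 1 (by omega))⟩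
      · refine ⟨w', ?_, hgood w' hw1⟩
        rw [hcol w w' hww']
        revert hε
        cases col w <;> cases ε <;> simp

end Far

/-! ### Ramsey-cofinite forests -/

section Main

variable {T : SimpleGraph V} {H G : SimpleGraph ℕ} {W : Set ℕ}

/-- If the large stars of leaves are neither far from every finite set nor accumulate at a vertex,
then one star is infinite and the others are bounded with finitely many exceptions. -/
theorem exists_infinite_leaves (hn : ∀ n : ℕ, ∃ x, (n : ℕ∞) ≤ (leaves T x).encard)
    (hA : ¬ ∀ S : Set V, S.Finite → ∀ n : ℕ, ∃ x ∉ S, (∀ s ∈ S, ¬ T.Adj x s) ∧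
      (n : ℕ∞) ≤ (leaves T x).encard)
    (hB : ¬ ∃ s, ∀ n : ℕ, {x | T.Adj s x ∧ (n : ℕ∞) ≤ (leaves T x).encard}.Infinite) :
    ∃ t, (leaves T t).Infinite ∧ ∃ (S : Set V) (m : ℕ), S.Finite ∧
      ∀ x ∉ S, (leaves T x).encard ≤ m := by
  push Not at hA hB
  obtain ⟨S, hS, n, hA⟩ := hA
  choose b hb using hB
  obtain ⟨m, hm⟩ := (hS.image b).bddAbove
  have hbd : ∀ x ∉ S ∪ ⋃ s ∈ S, {x | T.Adj s x ∧ (b s : ℕ∞) ≤ (leaves T x).encard},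
      (leaves T x).encard ≤ (max n m : ℕ) := by
    intro x hx
    rw [mem_union, not_or] at hx
    by_cases hadj : ∃ s ∈ S, T.Adj x s
    · obtain ⟨s, hs, hxs⟩ := hadj
      have h1 : (leaves T x).encard < b s := by
        by_contra h
        exact hx.2 (mem_biUnion hs ⟨hxs.symm, not_lt.1 h⟩)
      refine h1.le.trans ?_
      exact_mod_cast (hm ⟨s, hs, rfl⟩).trans (le_max_right n m)
    · push Not at hadj
      refine (hA x hx.1 hadj).le.trans ?_
      exact_mod_cast le_max_left n m
  have hfin : (S ∪ ⋃ s ∈ S, {x | T.Adj s x ∧ (b s : ℕ∞) ≤ (leaves T x).encard}).Finite :=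
    hS.union (hS.biUnion fun s _ => hb s)
  set S₁ := S ∪ ⋃ s ∈ S, {x | T.Adj s x ∧ (b s : ℕ∞) ≤ (leaves T x).encard}
  by_contra hno
  push Not at hno
  have hfl : ∀ t, (leaves T t).Finite := fun t => by
    by_contra h
    obtain ⟨x, hx, hlt⟩ := hno t h S₁ (max n m) hfin
    exact absurd (hbd x hx) hlt.not_ge
  obtain ⟨l, hl⟩ := (hfin.image fun t => (leaves T t).ncard).bddAbove
  obtain ⟨x, hx⟩ := hn (max (max n m) l + 1)
  have hle : (leaves T x).encard ≤ (max (max n m) l : ℕ) := by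
    by_cases hxS : x ∈ S₁
    · rw [← (hfl x).cast_ncard_eq]
      exact_mod_cast (hl ⟨x, hxS, rfl⟩).trans (le_max_right _ _)
    · refine (hbd x hxS).trans ?_
      exact_mod_cast le_max_left _ _
  have h2 := hx.trans hle
  have h3 : max (max n m) l + 1 ≤ max (max n m) l := by exact_mod_cast h2
  omega

theorem hasCofiniteCopy_of_infinite_leaves [Countable V] (hT : T.IsAcyclic)
    (hI : {v | T.neighborSet v = ∅}.Finite) (hD : ¬ HasFiniteDominatingSet T)
    (hTS : ¬ InTStar T) {t : V} (hleaf : (leaves T t).Infinite) {S₁ : Set V} (hS₁ : S₁.Finite)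
    {m : ℕ} (hb : ∀ x ∉ S₁, (leaves T x).encard ≤ m)
    (hc : ∀ u v, u ≠ v → H.Adj u v ∨ G.Adj u v) (hd : ∀ u v, H.Adj u v → ¬ G.Adj u v)
    (hW : Wᶜ.Finite) (hH : ∀ w ∈ W, (H.neighborSet w).Infinite)
    (hG : ∀ w ∈ W, (G.neighborSet w).Infinite) :
    HasCofiniteCopy T H ∨ HasCofiniteCopy T G := by
  by_cases hfar : ∀ S : Set V, S.Finite → ∃ w, w ∉ (closedNbhd T)^[5] S
  · obtain ⟨U, hU⟩ := exists_free_ultrafilter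
    rcases exists_linked_or hc hU with hR | hR
    · exact hasCofiniteCopy_of_far_vertices hT hI hfar hc hU hR hW hH
    · exact (hasCofiniteCopy_of_far_vertices hT hI hfar (fun u v h => (hc u v h).symm) hU hR hW
        hG).symm
  push Not at hfar
  obtain ⟨S, hS, hcov⟩ := hfar
  obtain ⟨t', ht'⟩ := exists_infinite_nonleaf_nbrs hD hS hcov
  by_cases hx : ∃ x, t' ≠ x ∧ (T.neighborSet x).Infinite
  · obtain ⟨x, hx, hxinf⟩ := hx
    exact hasCofiniteCopy_of_two_infinite_degrees hT hx ht' hxinf hc hd hW hH hG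
  push Not at hx
  obtain rfl : t' = t := by
    by_contra h
    exact (hleaf.mono fun v hv => hv.1 : (T.neighborSet t).Infinite) (hx t h)
  obtain ⟨ρ, ht⟩ := exists_rooting_at hT t'
  by_cases h3 : {p | ρ.par p = some t' ∧ ∃ q w, ρ.par q = some p ∧ ρ.par w = some q}.Infinite
  · exact hasCofiniteCopy_of_three_legs ρ ht h3 hc hW hH hG
  · exact absurd (inTStar_of_finite_three_legs hT ρ ht hleaf ht' (fun v hv => hx v hv.symm)
      (not_infinite.1 h3) hS hcov hS₁ hb) hTS

theorem finite_compl_neighborSet (hc : ∀ u v, u ≠ v → H.Adj u v ∨ G.Adj u v) {v : ℕ}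
    (h : (G.neighborSet v).Finite) : (H.neighborSet v)ᶜ.Finite := by
  refine (h.insert v).subset fun w hw => ?_
  by_cases hvw : v = w
  · exact Or.inl hvw.symm
  · exact Or.inr ((hc v w hvw).resolve_left hw)

/-- In every colouring one may assume that one colour has infinitely many vertices of cofinite
degree, or almost all vertices have infinite degree in both colours. -/
theorem hasCofiniteCopy_of_cases (hc : ∀ u v, u ≠ v → H.Adj u v ∨ G.Adj u v)
    (h1 : ∀ {H : SimpleGraph ℕ} {E : Set ℕ}, E.Infinite →
      (∀ e ∈ E, (H.neighborSet e)ᶜ.Finite) → HasCofiniteCopy T H)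
    (h2 : ∀ {W : Set ℕ}, Wᶜ.Finite → (∀ w ∈ W, (H.neighborSet w).Infinite) →
      (∀ w ∈ W, (G.neighborSet w).Infinite) → HasCofiniteCopy T H ∨ HasCofiniteCopy T G) :
    HasCofiniteCopy T H ∨ HasCofiniteCopy T G := by
  by_cases hG : {v | (G.neighborSet v).Finite}.Infinite
  · exact Or.inl (h1 hG fun e he => finite_compl_neighborSet hc he)
  by_cases hH : {v | (H.neighborSet v).Finite}.Infinite
  · exact Or.inr (h1 hH fun e he => finite_compl_neighborSet (fun u v h => (hc u v h).symm) he)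
  refine h2 (W := ({v | (H.neighborSet v).Finite} ∪ {v | (G.neighborSet v).Finite})ᶜ) ?_
    (fun w hw h => hw (Or.inl h)) (fun w hw h => hw (Or.inr h))
  rw [compl_compl]
  exact (not_infinite.1 hH).union (not_infinite.1 hG)

theorem hasCofiniteCopy_of_stronglyContracting [Countable V] (hT : T.IsAcyclic)
    (hS : StronglyContracting T) (hD : ¬ HasFiniteDominatingSet T) (hTS : ¬ InTStar T)
    (hc : ∀ u v, u ≠ v → H.Adj u v ∨ G.Adj u v) (hd : ∀ u v, H.Adj u v → ¬ G.Adj u v) :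
    HasCofiniteCopy T H ∨ HasCofiniteCopy T G := by
  obtain ⟨U, hU⟩ := exists_free_ultrafilter
  by_cases hI : {v | T.neighborSet v = ∅}.Infinite
  · exact (exists_linked_or hc hU).imp (hasCofiniteCopy_of_isolated hI hU)
      (hasCofiniteCopy_of_isolated hI hU)
  rw [not_infinite] at hI
  by_cases hA : ∀ S : Set V, S.Finite → ∀ n : ℕ, ∃ x ∉ S, (∀ s ∈ S, ¬ T.Adj x s) ∧
      (n : ℕ∞) ≤ (leaves T x).encard
  · rcases exists_linked_or hc hU with hR | hR
    · exact hasCofiniteCopy_of_far_stars hT hA hc hU hR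
    · exact (hasCofiniteCopy_of_far_stars hT hA (fun u v h => (hc u v h).symm) hU hR).symm
  by_cases hB : ∃ s, ∀ n : ℕ, {x | T.Adj s x ∧ (n : ℕ∞) ≤ (leaves T x).encard}.Infinite
  · obtain ⟨s, hs⟩ := hB
    exact hasCofiniteCopy_of_cases hc
      (fun hE hEH => hasCofiniteCopy_of_branching_of_cofinite_nbrs hT hs hE hEH)
      (fun hW hH hG => hasCofiniteCopy_of_branching_of_infinite_nbrs hT hs hc hW hH hG)
  obtain ⟨t, ht, S₁, m, hS₁, hb⟩ := exists_infinite_leaves (hS.exists_leaves hT hI) hA hB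
  exact hasCofiniteCopy_of_cases hc
    (fun hE hEH => hasCofiniteCopy_of_star_of_cofinite_nbrs hT ht hE hEH)
    (fun hW hH hG => hasCofiniteCopy_of_infinite_leaves hT hI hD hTS ht hS₁ hb hc hd hW hH hG)

theorem ramseyCofinite_of_stronglyContracting [Countable V] (hT : T.IsAcyclic)
    (hS : StronglyContracting T) (hD : ¬ HasFiniteDominatingSet T) (hTS : ¬ InTStar T) :
    RamseyCofinite T := by
  intro C
  have h := hasCofiniteCopy_of_stronglyContracting (H := C.labelGraph 0) (G := C.labelGraph 1) hT hS
    hD hTS (by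
      intro u v huv
      simp only [SimpleGraph.EdgeLabeling.labelGraph_adj]
      have h01 : C.get u v huv = 0 ∨ C.get u v huv = 1 := by omega
      exact h01.imp (fun h => ⟨huv, h⟩) fun h => ⟨huv, h⟩) (by
      intro u v h0 h1
      rw [SimpleGraph.EdgeLabeling.labelGraph_adj] at h0 h1
      obtain ⟨h, h0⟩ := h0
      obtain ⟨_, h1⟩ := h1
      rw [h0] at h1
      cases h1)
  rcases h with ⟨φ, hφ⟩ | ⟨φ, hφ⟩
  exacts [⟨0, φ, hφ⟩, ⟨1, φ, hφ⟩]

end Main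

end RamseyForest

theorem theorem1p10 {V : Type*} [Countable V] (T : SimpleGraph V) (hT : T.IsAcyclic) :
    (RamseyForest.StronglyContracting T → ¬ RamseyForest.HasFiniteDominatingSet T →
      ¬ RamseyForest.InTStar T → RamseyForest.RamseyCofinite T) ∧
    (RamseyForest.WeaklyExpanding T ∨ RamseyForest.HasFiniteDominatingSet T ∨
        RamseyForest.InTStar T →
      ¬ RamseyForest.RamseyLowerDense T ∧ ¬ RamseyForest.RamseyCofinite T) := by
  refine ⟨RamseyForest.ramseyCofinite_of_stronglyContracting hT, fun h => ?_⟩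
  have h' : ¬ RamseyForest.RamseyLowerDense T := by
    rcases h with h | h | h
    · exact RamseyForest.not_ramseyLowerDense_of_weaklyExpanding h
    · exact RamseyForest.not_ramseyLowerDense_of_hasFiniteDominatingSet h
    · exact RamseyForest.not_ramseyLowerDense_of_inTStar h
  exact ⟨h', RamseyForest.not_ramseyCofinite_of_not_ramseyLowerDense h'⟩
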